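/- Let $k\ge 1$ and $d\ge 1$ be integers. A $k$-local Hamiltonian on $n$ qudits of local dimension $d$ is a Hermitian $d^n\times d^n$ matrix $H=\sum_{e\in E}H_e\otimes \mathbb{I}_{[n]\setminus e}$, where $E$ is a set of (ordered) $k$-tuples $e=(u_1,\dots,u_k)$ of distinct elements of $[n]$, and for each $e\in E$ the interaction $H_e$ is a Hermitian $d^k\times d^k$ matrix acting on the qudits $u_1,\dots,u_k$. Write $m=|E|$ for the number of interactions, $\|\cdot\|_\infty$ for the spectral norm, $J_e=\|H_e\|_\infty$ for $e\in E$ and $J_e=0$ otherwise, $|J|_1=\sum_e |J_e|$ and $\|J\|_F=(\sum_e J_e^2)^{1/2}$. There is a constant $C$ depending only on $k$ and $d$ such that the following two statements hold for every $n$ and every $k$-local Hamiltonian $H$ on $n$ qudits of local dimension $d$. (1) If $\|H_e\|_\infty\le 1$ for all $e\in E$, then there is a pure product state $|\psi\rangle=\bigotimes_{u\in[n]}|\psi_u\rangle$, with unit vectors $|\psi_u\rangle\in\mathbb{C}^d$, such that $$\langle\psi|H|\psi\rangle\le \min_{\|\phi\|=1}\langle\phi|H|\phi\rangle + C\, n^{\frac{k-1}{3}}m^{2/3},$$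 where the minimum is over all unit vectors $|\phi\rangle\in(\mathbb{C}^d)^{\otimes n}$. (2) For every density matrix $\rho$ on the $n$ qudits and every integer $l$ with $0<l<n$ there is a separable state $\sigma$, that is, a convex combination of tensor products of $n$ single-qudit density matrices, such that $$\bigl|\operatorname{Tr}[H(\rho-\sigma)]\bigr|\le C\left(\frac{l}{n}\,|J|_1+\frac{n^{k/2}}{\sqrt{l}}\,\|J\|_F\right).$$ -/

import Mathlib

open scoped ComplexOrder

namespace Qudit

/-- The Hilbert space `(ℂ^d)^{⊗ι}` of qudits of local dimension `d` labelled by `ι`, in the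
computational basis `|x⟩`, `x : ι → Fin d`. -/
abbrev Space (ι : Type) [Fintype ι] (d : ℕ) : Type :=
  EuclideanSpace ℂ (ι → Fin d)

/-- Operators on `(ℂ^d)^{⊗ι}`, as matrices in the computational basis. -/
abbrev Op (ι : Type) (d : ℕ) : Type :=
  Matrix (ι → Fin d) (ι → Fin d) ℂ

/-- The spectral norm `‖A‖_∞` (largest singular value): the operator norm of `A` for the Euclidean
norm. -/
noncomputable def specNorm {ι : Type} [Fintype ι] [DecidableEq ι] {d : ℕ} (A : Op ι d) : ℝ :=
  ‖Matrix.toEuclideanCLM (𝕜 := ℂ) A‖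

/-- The energy `⟨φ|A|φ⟩` (a real number when `A` is Hermitian). -/
noncomputable def energy {n d : ℕ} (A : Op (Fin n) d) (φ : Space (Fin n) d) : ℝ :=
  (inner ℂ φ (Matrix.toEuclideanCLM (𝕜 := ℂ) A φ)).re

/-- The ground state energy: the minimum of `⟨φ|A|φ⟩` over all unit vectors `φ`
(it is attained when `d` is positive, see `isLeast_groundEnergy`). -/
noncomputable def groundEnergy {n d : ℕ} (A : Op (Fin n) d) : ℝ :=
  sInf (energy A '' Metric.sphere 0 1)

theorem isLeast_groundEnergy {n d : ℕ} (hd : 0 < d) (A : Op (Fin n) d) :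
    IsLeast (energy A '' Metric.sphere 0 1) (groundEnergy A) := by
  have hc : Continuous (energy A) := by
    unfold energy
    fun_prop
  have hK : IsCompact (energy A '' Metric.sphere 0 1) := (isCompact_sphere _ _).image hc
  refine hK.isLeast_sInf (Set.Nonempty.image _ ?_)
  exact ⟨EuclideanSpace.single (fun _ => ⟨0, hd⟩) 1, by simp⟩

/-- The vector `⊗_u |ψ_u⟩`. -/
noncomputable def tensorVec {n d : ℕ} (ψ : Fin n → EuclideanSpace ℂ (Fin d)) : Space (Fin n) d :=
  WithLp.toLp 2 fun x => ∏ u, ψ u (x u)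

/-- The operator `⊗_u τ_u`. -/
noncomputable def tensorOp {n d : ℕ} (τ : Fin n → Matrix (Fin d) (Fin d) ℂ) : Op (Fin n) d :=
  Matrix.of fun x y => ∏ u, τ u (x u) (y u)

/-- Density matrices: positive semidefinite of trace one. -/
def IsDensity {α : Type} [Fintype α] (ρ : Matrix α α ℂ) : Prop :=
  ρ.PosSemidef ∧ ρ.trace = 1

/-- (Fully) separable states of `n` qudits: convex combinations of tensor products of single-qudit
density matrices. -/
def IsSeparableState {n d : ℕ} (σ : Op (Fin n) d) : Prop :=
  σ ∈ convexHull ℝ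
    {η : Op (Fin n) d | ∃ τ : Fin n → Matrix (Fin d) (Fin d) ℂ,
      (∀ u, IsDensity (τ u)) ∧ η = tensorOp τ}

/-- `A ⊗ I`: the operator on `n` qudits that acts as `A` on the qudits `e 0, …, e (k - 1)` (in this
order) and as the identity on all the others. -/
def extend {k n d : ℕ} (e : Fin k ↪ Fin n) (A : Op (Fin k) d) : Op (Fin n) d :=
  Matrix.of fun x y =>
    if ∀ u, (∀ i, e i ≠ u) → x u = y u then A (fun i => x (e i)) (fun i => y (e i)) else 0

/-- A `k`-local Hamiltonian on `n` qudits of local dimension `d`: a set `E` of hyperedges, which are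
`k`-tuples of distinct qudits, and for each of them a Hermitian interaction `H_e`, a `d^k × d^k`
matrix. There is at most one interaction per tuple. -/
structure LocalHamiltonian (k n d : ℕ) where
  edges : Finset (Fin k ↪ Fin n)
  term : (Fin k ↪ Fin n) → Op (Fin k) d
  isHermitian : ∀ e ∈ edges, (term e).IsHermitian

namespace LocalHamiltonian

variable {k n d : ℕ}

/-- The `d^n × d^n` matrix `H = ∑_{e ∈ E} H_e ⊗ I`. -/
noncomputable def toOp (H : LocalHamiltonian k n d) : Op (Fin n) d :=
  ∑ e ∈ H.edges, extend e (H.term e)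

/-- The array of interaction strengths, `J_e = ‖H_e‖_∞` on the hyperedges and zero elsewhere. -/
noncomputable def strength (H : LocalHamiltonian k n d) (e : Fin k ↪ Fin n) : ℝ :=
  if e ∈ H.edges then specNorm (H.term e) else 0

/-- `|J|_1 = ∑_e |J_e|`. -/
noncomputable def strengthL1 (H : LocalHamiltonian k n d) : ℝ :=
  ∑ e, |H.strength e|

/-- `‖J‖_F = (∑_e J_e ^ 2) ^ (1 / 2)`. -/
noncomputable def strengthFrob (H : LocalHamiltonian k n d) : ℝ :=
  √(∑ e, H.strength e ^ 2)

end LocalHamiltonian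

end Qudit

open Qudit

/-! Measure every qudit of `ρ` with an informationally complete measurement (`povm`). This gives a
classical distribution `p` on outcomes, from which all local expectations can be recovered linearly
(`eq_sum_povmCoeff`, `trace_extend_mul`). Fix a set `C` of sites. Averaging over `p` the tensor
product of the single-qudit states conditioned on the outcomes in `C` gives a separable `σ`. On a
tuple that avoids `C`, comparing `ρ` with `σ` means comparing the joint outcome probabilities with
products of conditional ones.

The set `C` consists of `c` random sites, with `c` uniform below `l`. The potential is `predict`,
the expected sum of squared conditional probabilities of a site's outcomes. It lies in `[0, 1]` and
grows with the conditioning set, so its increments telescope and are on average at most `r / l` when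
`r` further random sites are added. By orthogonality of conditional expectations, the increments
control the failure of independence (`abs_sum_prod_siteInd_sub_le`). Cauchy–Schwarz against the
strengths gives the `‖J‖_F` term; tuples meeting `C`, at most a fraction `(r + 1) l / n` on average,
are bounded trivially and give the `|J|_1` term. `exists_conditioning_set` fixes one good `C`, and
`exists_separable_approx` transfers it to `ρ`.

For the ground state bound, `ρ` is a ground state and `l` balances the two errors. Since energy is
linear in the state, some pure product state does no worse than `σ`. -/

namespace Qudit

/-! ### Classical conditioning and near independence. -/

section Indicator

variable {α Ω : Type*} [DecidableEq Ω]

/-- The indicator function of the event that the site `u` has the value `b`. -/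
def siteInd (u : α) (b : Ω) (y : α → Ω) : ℝ := if y u = b then 1 else 0

theorem siteInd_nonneg (u : α) (b : Ω) (y : α → Ω) : 0 ≤ siteInd u b y := by
  unfold siteInd; split_ifs <;> norm_num

theorem siteInd_le_one (u : α) (b : Ω) (y : α → Ω) : siteInd u b y ≤ 1 := by
  unfold siteInd; split_ifs <;> norm_num

theorem dependsOn_siteInd (u : α) (b : Ω) {S : Finset α} (hu : u ∈ S) :
    DependsOn (siteInd u b) (S : Set α) := fun x y h => by
  have := h u hu
  simp only [siteInd, this]

end Indicator

section Conditional

variable {α Ω : Type*} [DecidableEq α] [Fintype α] [DecidableEq Ω] [Fintype Ω]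

/-- The configurations that agree with `x` on the sites in `S`. -/
def cyl (S : Finset α) (x : α → Ω) : Finset (α → Ω) :=
  Finset.univ.filter fun y => ∀ v ∈ S, y v = x v

theorem mem_cyl {S : Finset α} {x y : α → Ω} : y ∈ cyl S x ↔ ∀ v ∈ S, y v = x v := by
  simp [cyl]

theorem mem_cyl_comm {S : Finset α} {x y : α → Ω} : y ∈ cyl S x ↔ x ∈ cyl S y := by
  simp only [mem_cyl, eq_comm]

theorem cyl_congr {S : Finset α} {x y : α → Ω} (h : ∀ v ∈ S, x v = y v) :
    cyl S x = cyl S y := by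
  ext z
  simp only [mem_cyl]
  exact forall₂_congr fun v hv => by rw [h v hv]

/-- The conditional expectation of `g` given the sites in `S`, for the weights `p`. -/
noncomputable def condE (p : (α → Ω) → ℝ) (S : Finset α) (g : (α → Ω) → ℝ) (x : α → Ω) : ℝ :=
  (∑ y ∈ cyl S x, p y * g y) / ∑ y ∈ cyl S x, p y

theorem dependsOn_condE (p : (α → Ω) → ℝ) (S : Finset α) (g : (α → Ω) → ℝ) :
    DependsOn (condE p S g) (S : Set α) := by
  intro x y h
  have : cyl S x = cyl S y := cyl_congr fun v hv => h v (by simpa using hv)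
  simp only [condE, this]

variable {p : (α → Ω) → ℝ}

theorem condE_nonneg (hp : ∀ x, 0 ≤ p x) (S : Finset α) {g : (α → Ω) → ℝ} (hg : ∀ x, 0 ≤ g x)
    (x : α → Ω) : 0 ≤ condE p S g x :=
  div_nonneg (Finset.sum_nonneg fun y _ => mul_nonneg (hp y) (hg y))
    (Finset.sum_nonneg fun y _ => hp y)

theorem condE_le_one (hp : ∀ x, 0 ≤ p x) (S : Finset α) {g : (α → Ω) → ℝ} (hg : ∀ x, g x ≤ 1)
    (x : α → Ω) : condE p S g x ≤ 1 :=
  div_le_one_of_le₀ (Finset.sum_le_sum fun y _ => mul_le_of_le_one_right (hp y) (hg y))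
    (Finset.sum_nonneg fun y _ => hp y)

/-- The defining property of conditional expectation: `h` is constant on cylinders over `S`, so it
can be moved inside the average over a cylinder. -/
theorem sum_condE_mul (hp : ∀ x, 0 ≤ p x) (S : Finset α) (g : (α → Ω) → ℝ) {h : (α → Ω) → ℝ}
    (hh : DependsOn h (S : Set α)) :
    ∑ x, p x * (condE p S g x * h x) = ∑ x, p x * (g x * h x) := by
  have h1 : ∀ x, p x * (condE p S g x * h x) =
      ∑ y, if y ∈ cyl S x then p x * p y * g y * h y / ∑ z ∈ cyl S y, p z else 0 := by
    intro x
    rw [← Finset.sum_filter, condE, Finset.sum_div, Finset.sum_mul, Finset.mul_sum]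
    have : Finset.univ.filter (fun y => y ∈ cyl S x) = cyl S x := by ext; simp
    rw [this]
    refine Finset.sum_congr rfl fun y hy => ?_
    rw [mem_cyl] at hy
    rw [cyl_congr hy, hh (x := y) (y := x) fun v hv => hy v (by simpa using hv)]
    ring
  simp only [h1]
  rw [Finset.sum_comm]
  refine Finset.sum_congr rfl fun y _ => ?_
  simp only [mem_cyl_comm (x := _) (y := y)]
  rw [← Finset.sum_filter]
  have : Finset.univ.filter (fun x => x ∈ cyl S y) = cyl S y := by ext; simp
  rw [this]
  have h2 : ∀ x, p x * p y * g y * h y / ∑ z ∈ cyl S y, p z =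
      p x * (p y * g y * h y / ∑ z ∈ cyl S y, p z) := fun x => by ring
  simp only [h2]
  rw [← Finset.sum_mul]
  -- On a null cylinder `condE` is the default value `0`; this is harmless because `p y` vanishes
  -- there too.
  by_cases h0 : ∑ z ∈ cyl S y, p z = 0
  · have : p y = 0 := (Finset.sum_eq_zero_iff_of_nonneg fun z _ => hp z).1 h0 y (by simp [mem_cyl])
    simp [this]
  · field_simp

/-- The second moment of the conditional expectation of `g` given the sites in `S`. -/
noncomputable def condSq (p : (α → Ω) → ℝ) (S : Finset α) (g : (α → Ω) → ℝ) : ℝ :=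
  ∑ x, p x * condE p S g x ^ 2

theorem condSq_nonneg (hp : ∀ x, 0 ≤ p x) (S : Finset α) (g : (α → Ω) → ℝ) : 0 ≤ condSq p S g :=
  Finset.sum_nonneg fun x _ => mul_nonneg (hp x) (sq_nonneg _)

/-- Pythagoras: `condE p S` is the orthogonal projection in `L²(p)` onto the functions of the sites
in `S`, a subspace of those of `T`. -/
theorem sum_sq_condE_sub (hp : ∀ x, 0 ≤ p x) {S T : Finset α} (hST : S ⊆ T)
    (g : (α → Ω) → ℝ) :
    ∑ x, p x * (condE p T g x - condE p S g x) ^ 2 = condSq p T g - condSq p S g := by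
  have h1 := sum_condE_mul hp S g (dependsOn_condE p S g)
  have hS : DependsOn (condE p S g) (T : Set α) := fun x y h =>
    dependsOn_condE p S g fun v hv => h v (hST hv)
  have h2 := sum_condE_mul hp T g hS
  have : ∀ x, p x * (condE p T g x - condE p S g x) ^ 2 = p x * condE p T g x ^ 2
      - 2 * (p x * (condE p T g x * condE p S g x)) + p x * (condE p S g x * condE p S g x) :=
    fun x => by ring
  simp only [this, Finset.sum_add_distrib, Finset.sum_sub_distrib, ← Finset.mul_sum, h2, h1]
  have h3 : condSq p S g = ∑ x, p x * (condE p S g x * condE p S g x) := by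
    simp only [condSq, sq]
  rw [h1] at h3
  rw [h3, condSq]
  ring

theorem condSq_mono (hp : ∀ x, 0 ≤ p x) {S T : Finset α} (hST : S ⊆ T) (g : (α → Ω) → ℝ) :
    condSq p S g ≤ condSq p T g := by
  rw [← sub_nonneg, ← sum_sq_condE_sub hp hST]
  exact Finset.sum_nonneg fun x _ => mul_nonneg (hp x) (sq_nonneg _)

theorem condSq_le (hp : ∀ x, 0 ≤ p x) (S : Finset α) {g : (α → Ω) → ℝ} (hg : ∀ x, 0 ≤ g x)
    (hg1 : ∀ x, g x ≤ 1) : condSq p S g ≤ ∑ x, p x * g x := by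
  have h := sum_condE_mul hp S g (h := fun _ => 1) fun _ _ _ => rfl
  simp only [mul_one] at h
  rw [← h]
  refine Finset.sum_le_sum fun x _ => mul_le_mul_of_nonneg_left ?_ (hp x)
  have h0 := condE_nonneg hp S hg x
  have h1 := condE_le_one hp S hg1 x
  nlinarith

/-- Since `h` sees only the sites in `T`, `g` may be replaced by `condE p T g`; Cauchy–Schwarz and
Pythagoras do the rest. -/
theorem abs_sum_sub_condE_le (hp : ∀ x, 0 ≤ p x) (hp1 : ∑ x, p x = 1) {S T : Finset α}
    (hST : S ⊆ T) (g : (α → Ω) → ℝ) {h : (α → Ω) → ℝ} (hh : DependsOn h (T : Set α))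
    (hh1 : ∀ x, |h x| ≤ 1) :
    |∑ x, p x * ((g x - condE p S g x) * h x)| ≤ √(condSq p T g - condSq p S g) := by
  have h1 : ∑ x, p x * ((g x - condE p S g x) * h x) =
      ∑ x, p x * (condE p T g x - condE p S g x) * h x := by
    have := sum_condE_mul hp T g hh
    simp only [sub_mul, mul_sub, Finset.sum_sub_distrib, ← this, mul_assoc]
  rw [h1, ← sum_sq_condE_sub hp hST]
  refine Real.abs_le_sqrt ?_
  calc (∑ x, p x * (condE p T g x - condE p S g x) * h x) ^ 2
      ≤ (∑ x, p x) * ∑ x, p x * (condE p T g x - condE p S g x) ^ 2 * h x ^ 2 :=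
        Finset.sum_sq_le_sum_mul_sum_of_sq_le_mul _ (fun x _ => hp x)
          (fun x _ => mul_nonneg (mul_nonneg (hp x) (sq_nonneg _)) (sq_nonneg _))
          (fun x _ => le_of_eq (by ring))
    _ ≤ _ := by
        rw [hp1, one_mul]
        refine Finset.sum_le_sum fun x _ => ?_
        exact mul_le_of_le_one_right (mul_nonneg (hp x) (sq_nonneg _))
          ((sq_le_one_iff_abs_le_one _).2 (hh1 x))

/-- A hybrid argument: factors are replaced by their conditional expectations one at a time. The
weight `w` carries the factors already replaced, while the untouched ones depend only on `T j`. -/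
theorem abs_sum_prod_sub_prod_condE_le (hp : ∀ x, 0 ≤ p x) (hp1 : ∑ x, p x = 1) {κ : Type*}
    [DecidableEq κ] (s : Finset κ) (S : Finset α) (T : κ → Finset α) (hST : ∀ j, S ⊆ T j)
    (g : κ → (α → Ω) → ℝ) (hg0 : ∀ i x, 0 ≤ g i x) (hg1 : ∀ i x, g i x ≤ 1)
    (hgT : ∀ i j, i ≠ j → DependsOn (g i) (T j : Set α)) (w : (α → Ω) → ℝ)
    (hw : DependsOn w (S : Set α)) (hw1 : ∀ x, |w x| ≤ 1) :
    |∑ x, p x * ((∏ i ∈ s, g i x) * w x) - ∑ x, p x * ((∏ i ∈ s, condE p S (g i) x) * w x)| ≤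
      ∑ j ∈ s, √(condSq p (T j) (g j) - condSq p S (g j)) := by
  induction s using Finset.induction_on generalizing w with
  | empty => simp
  | insert a s ha ih =>
    have hw' : DependsOn (fun x => condE p S (g a) x * w x) (S : Set α) := fun x y h => by
      simp only [dependsOn_condE p S (g a) h, hw h]
    have hw1' : ∀ x, |condE p S (g a) x * w x| ≤ 1 := fun x => by
      rw [abs_mul, abs_of_nonneg (condE_nonneg hp S (hg0 a) x)]
      exact mul_le_one₀ (condE_le_one hp S (hg1 a) x) (abs_nonneg _) (hw1 x)
    have h1 := ih _ hw' hw1'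
    have h2 := abs_sum_sub_condE_le hp hp1 (hST a) (g a)
      (h := fun x => (∏ i ∈ s, g i x) * w x)
      (fun x y h => by
        have e1 : w x = w y := hw fun v hv => h v (hST a hv)
        have e2 : ∏ i ∈ s, g i x = ∏ i ∈ s, g i y := Finset.prod_congr rfl fun i hi =>
          hgT i a (fun hia => ha (hia ▸ hi)) h
        simp only [e1, e2])
      (fun x => by
        have h0 : 0 ≤ ∏ i ∈ s, g i x := Finset.prod_nonneg fun i _ => hg0 i x
        rw [abs_mul, abs_of_nonneg h0]
        exact mul_le_one₀ (Finset.prod_le_one (fun i _ => hg0 i x) fun i _ => hg1 i x)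
          (abs_nonneg _) (hw1 x))
    rw [Finset.sum_insert ha]
    refine le_trans (le_of_eq ?_) ((abs_add_le _ _).trans (add_le_add h2 h1))
    congr 1
    rw [← Finset.sum_sub_distrib, ← Finset.sum_sub_distrib, ← Finset.sum_add_distrib]
    refine Finset.sum_congr rfl fun x _ => ?_
    rw [Finset.prod_insert ha, Finset.prod_insert ha]
    ring

/-- How well the value of the site `u` is predicted by the sites in `S`. -/
noncomputable def predict (p : (α → Ω) → ℝ) (u : α) (S : Finset α) : ℝ :=
  ∑ b, condSq p S (siteInd u b)

theorem predict_nonneg (hp : ∀ x, 0 ≤ p x) (u : α) (S : Finset α) : 0 ≤ predict p u S :=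
  Finset.sum_nonneg fun _ _ => condSq_nonneg hp _ _

theorem predict_le_one (hp : ∀ x, 0 ≤ p x) (hp1 : ∑ x, p x = 1) (u : α) (S : Finset α) :
    predict p u S ≤ 1 := by
  calc predict p u S ≤ ∑ b, ∑ x, p x * siteInd u b x :=
        Finset.sum_le_sum fun b _ => condSq_le hp S (siteInd_nonneg u b) (siteInd_le_one u b)
    _ = 1 := by
        rw [Finset.sum_comm, ← hp1]
        refine Finset.sum_congr rfl fun x _ => ?_
        simp [siteInd]

theorem predict_mono (hp : ∀ x, 0 ≤ p x) (u : α) {S T : Finset α} (hST : S ⊆ T) :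
    predict p u S ≤ predict p u T :=
  Finset.sum_le_sum fun _ _ => condSq_mono hp hST _

theorem condSq_sub_le_predict_sub (hp : ∀ x, 0 ≤ p x) (u : α) (b : Ω) {S T : Finset α}
    (hST : S ⊆ T) : condSq p T (siteInd u b) - condSq p S (siteInd u b) ≤
      predict p u T - predict p u S := by
  rw [predict, predict, ← Finset.sum_sub_distrib]
  exact Finset.single_le_sum
    (f := fun b => condSq p T (siteInd u b) - condSq p S (siteInd u b))
    (fun b _ => sub_nonneg.2 (condSq_mono hp hST _)) (Finset.mem_univ b)

theorem abs_sum_prod_siteInd_sub_le (hp : ∀ x, 0 ≤ p x) (hp1 : ∑ x, p x = 1) {r : ℕ}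
    (e : Fin (r + 1) → α) (ω : Fin (r + 1) → Ω) (S : Finset α) :
    |∑ x, p x * ∏ i, siteInd (e i) (ω i) x - ∑ x, p x * ∏ i, condE p S (siteInd (e i) (ω i)) x| ≤
      ∑ j, √(predict p (e j) (S ∪ Finset.univ.image (e ∘ j.succAbove)) - predict p (e j) S) := by
  have h := abs_sum_prod_sub_prod_condE_le hp hp1 Finset.univ S
    (fun j => S ∪ Finset.univ.image (e ∘ j.succAbove)) (fun j => Finset.subset_union_left)
    (fun i => siteInd (e i) (ω i)) (fun i => siteInd_nonneg _ _) (fun i => siteInd_le_one _ _)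
    (fun i j hij => dependsOn_siteInd _ _ (by
      obtain ⟨i', rfl⟩ := Fin.exists_succAbove_eq hij
      exact Finset.mem_union_right _ (Finset.mem_image_of_mem (e ∘ j.succAbove)
        (Finset.mem_univ i')))) (fun _ => 1)
    (fun _ _ _ => rfl) (by simp)
  simp only [mul_one] at h
  exact h.trans (Finset.sum_le_sum fun j _ => Real.sqrt_le_sqrt
    (condSq_sub_le_predict_sub hp _ _ Finset.subset_union_left))

end Conditional

/-! ### Random conditioning sets. -/

section Averaging

variable {α : Type*} [DecidableEq α] [Fintype α]

/-- The operator that averages a function of a set of sites over the insertion of a uniformly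
random site. -/
noncomputable def avg (α : Type*) [DecidableEq α] [Fintype α] :
    Module.End ℝ (Finset α → ℝ) where
  toFun F C := (∑ v, F (insert v C)) / Fintype.card α
  map_add' F G := by
    ext C
    simp [Finset.sum_add_distrib, add_div]
  map_smul' a F := by
    ext C
    simp [← Finset.mul_sum, mul_div_assoc]

theorem avg_apply (F : Finset α → ℝ) (C : Finset α) :
    avg α F C = (∑ v, F (insert v C)) / Fintype.card α := rfl

theorem avg_pow_succ_apply (c : ℕ) (F : Finset α → ℝ) (C : Finset α) :
    (avg α ^ (c + 1)) F C = (∑ v, (avg α ^ c) F (insert v C)) / Fintype.card α := by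
  rw [pow_succ', Module.End.mul_apply, avg_apply]

theorem avg_pow_mono {F G : Finset α → ℝ} (h : ∀ C, F C ≤ G C) (c : ℕ) (C : Finset α) :
    (avg α ^ c) F C ≤ (avg α ^ c) G C := by
  induction c generalizing C with
  | zero => exact h C
  | succ c ih =>
    rw [avg_pow_succ_apply, avg_pow_succ_apply]
    gcongr
    exact ih _

theorem avg_pow_const [Nonempty α] (a : ℝ) (c : ℕ) (C : Finset α) :
    (avg α ^ c) (fun _ => a) C = a := by
  induction c generalizing C with
  | zero => rfl
  | succ c ih =>
    rw [avg_pow_succ_apply]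
    simp [ih]

theorem sum_union_image (c : ℕ) (F : Finset α → ℝ) (C : Finset α) :
    ∑ v : Fin c → α, F (C ∪ Finset.univ.image v) =
      (Fintype.card α : ℝ) ^ c * (avg α ^ c) F C := by
  induction c generalizing C with
  | zero => simp
  | succ c ih =>
    rw [← (Fin.consEquiv fun _ => α).sum_comp, Fintype.sum_prod_type]
    have h : ∀ (a : α) (v : Fin c → α), C ∪ Finset.univ.image (Fin.consEquiv (fun _ => α) (a, v)) =
        insert a C ∪ Finset.univ.image v := fun a v => by
      ext u
      simp [Fin.exists_fin_succ, Fin.consEquiv, eq_comm]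
      tauto
    simp only [h, ih]
    rw [avg_pow_succ_apply, ← Finset.mul_sum, pow_succ]
    rcases isEmpty_or_nonempty α with h0 | h0
    · simp
    · have : (Fintype.card α : ℝ) ≠ 0 := by simp
      field_simp

/-- The average of a function of a set of sites over the sets of `c` independent uniformly random
sites, where `c` is uniformly random in `{0, …, l - 1}`. -/
noncomputable def avgRange (α : Type*) [DecidableEq α] [Fintype α] (l : ℕ) :
    (Finset α → ℝ) →ₗ[ℝ] ℝ where
  toFun F := (∑ c ∈ Finset.range l, (avg α ^ c) F ∅) / l
  map_add' F G := by simp [Finset.sum_add_distrib, add_div]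
  map_smul' a F := by simp [← Finset.mul_sum, mul_div_assoc]

theorem avgRange_apply (l : ℕ) (F : Finset α → ℝ) :
    avgRange α l F = (∑ c ∈ Finset.range l, (avg α ^ c) F ∅) / l := rfl

theorem avgRange_mono {F G : Finset α → ℝ} (h : ∀ C, F C ≤ G C) (l : ℕ) :
    avgRange α l F ≤ avgRange α l G := by
  rw [avgRange_apply, avgRange_apply]
  gcongr
  exact avg_pow_mono h _ _

theorem avgRange_const [Nonempty α] {l : ℕ} (hl : 0 < l) (a : ℝ) :
    avgRange α l (fun _ => a) = a := by
  have : (l : ℝ) ≠ 0 := by positivity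
  simp [avgRange_apply, avg_pow_const]
  field_simp

/-- The probabilistic method: some set does at least as well as the average. -/
theorem exists_le_avgRange [Nonempty α] {l : ℕ} (hl : 0 < l) (F : Finset α → ℝ) :
    ∃ C, F C ≤ avgRange α l F := by
  obtain ⟨C, -, hC⟩ := Finset.exists_min_image Finset.univ F Finset.univ_nonempty
  refine ⟨C, ?_⟩
  rw [← avgRange_const (α := α) hl (F C)]
  exact avgRange_mono (fun D => hC D (Finset.mem_univ D)) l

/-- A union bound: each of the `c` random sites equals `u` with probability `1 / Fintype.card α`. -/
theorem avg_pow_mem_le (u : α) (c : ℕ) (C : Finset α) :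
    (avg α ^ c) (fun D => if u ∈ D then 1 else 0) C ≤
      (if u ∈ C then 1 else 0) + (c : ℝ) / Fintype.card α := by
  have hα : 0 < (Fintype.card α : ℝ) := by
    have : Nonempty α := ⟨u⟩
    positivity
  induction c generalizing C with
  | zero => simp
  | succ c ih =>
    rw [avg_pow_succ_apply]
    have h1 : ∀ v, (avg α ^ c) (fun D => if u ∈ D then (1 : ℝ) else 0) (insert v C) ≤
        (if v = u then 1 else 0) + ((if u ∈ C then 1 else 0) + (c : ℝ) / Fintype.card α) := by
      intro v
      refine (ih (insert v C)).trans ?_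
      rw [← add_assoc]
      gcongr
      by_cases h1 : u = v <;> by_cases h2 : u ∈ C <;> simp [h1, h2, eq_comm] <;> grind
    calc _ ≤ (∑ v, ((if v = u then 1 else 0) +
            ((if u ∈ C then 1 else 0) + (c : ℝ) / Fintype.card α))) / Fintype.card α := by
          gcongr with v
          exact h1 v
      _ = _ := by
          rw [Finset.sum_add_distrib]
          simp only [Finset.sum_ite_eq', Finset.mem_univ, if_true, Finset.sum_const,
            Finset.card_univ, nsmul_eq_mul]
          push_cast
          field_simp
          ring

theorem avgRange_mem_le (u : α) (l : ℕ) :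
    avgRange α l (fun D => if u ∈ D then 1 else 0) ≤ (l : ℝ) / Fintype.card α := by
  rcases Nat.eq_zero_or_pos l with rfl | hl
  · simp [avgRange_apply]
  have hl' : (0 : ℝ) < l := by positivity
  rw [avgRange_apply, div_le_iff₀ hl']
  calc _ ≤ ∑ c ∈ Finset.range l, (l : ℝ) / Fintype.card α := by
        refine Finset.sum_le_sum fun c hc => (avg_pow_mem_le u c ∅).trans ?_
        simp only [Finset.notMem_empty, if_false, zero_add]
        gcongr
        exact (Finset.mem_range.1 hc).le
    _ = _ := by simp [mul_comm]

/-- A shift by `r` is `r` unit shifts, each of which telescopes to a difference of two values in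
`[0, 1]`. -/
theorem sum_range_shift_sub_le {a : ℕ → ℝ} (h0 : ∀ c, 0 ≤ a c) (h1 : ∀ c, a c ≤ 1) (l r : ℕ) :
    ∑ c ∈ Finset.range l, (a (c + r) - a c) ≤ r := by
  induction r with
  | zero => simp
  | succ r ih =>
    have : ∑ c ∈ Finset.range l, (a (c + (r + 1)) - a c) =
        ∑ c ∈ Finset.range l, (a (c + 1 + r) - a (c + r)) +
          ∑ c ∈ Finset.range l, (a (c + r) - a c) := by
      rw [← Finset.sum_add_distrib]
      exact Finset.sum_congr rfl fun c _ => by rw [show c + (r + 1) = c + 1 + r by ring]; ring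
    rw [this, Finset.sum_range_sub fun c => a (c + r)]
    push_cast
    linarith [h1 (l + r), h0 (0 + r)]

theorem avgRange_avg_pow_sub_le [Nonempty α] {ψ : Finset α → ℝ} (h0 : ∀ C, 0 ≤ ψ C)
    (h1 : ∀ C, ψ C ≤ 1) (l r : ℕ) :
    avgRange α l ((avg α ^ r) ψ - ψ) ≤ (r : ℝ) / l := by
  rw [avgRange_apply]
  gcongr
  refine le_trans (le_of_eq ?_) (sum_range_shift_sub_le (a := fun c => (avg α ^ c) ψ ∅)
    (fun c => ?_) (fun c => ?_) l r)
  · refine Finset.sum_congr rfl fun c _ => ?_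
    rw [map_sub, ← Module.End.mul_apply, ← pow_add]
    rfl
  · exact (avg_pow_const (α := α) 0 c ∅).symm.le.trans (avg_pow_mono h0 c ∅)
  · exact (avg_pow_mono h1 c ∅).trans (avg_pow_const (α := α) 1 c ∅).le

/-- The sum over all tuples `e` of the information that the other sites of `e` yield about the
`j`-th one, beyond that of `C`, in terms of the averaging operator. -/
theorem sum_tuples_sub_eq [Nonempty α] {r : ℕ} (j : Fin (r + 1)) (ψ : α → Finset α → ℝ)
    (C : Finset α) :
    ∑ e : Fin (r + 1) → α, (ψ (e j) (C ∪ Finset.univ.image (e ∘ j.succAbove)) - ψ (e j) C) =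
      (Fintype.card α : ℝ) ^ (r + 1) *
        ((avg α ^ r) (fun D => (∑ u, ψ u D) / Fintype.card α) C -
          (∑ u, ψ u C) / Fintype.card α) := by
  have hα : (Fintype.card α : ℝ) ≠ 0 := by simp
  -- Splitting off the `j`-th entry leaves `r` free sites, and inserting these into `C` is `r`
  -- applications of `avg`.
  rw [← (Fin.insertNthEquiv (fun _ => α) j).sum_comp, Fintype.sum_prod_type]
  have h : ∀ (a : α) (v : Fin r → α),
      (Fin.insertNthEquiv (fun _ => α) j (a, v)) ∘ j.succAbove = v := fun a v => by
    ext i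
    simp [Fin.insertNthEquiv]
  have h' : ∀ (a : α) (v : Fin r → α), Fin.insertNthEquiv (fun _ => α) j (a, v) j = a :=
    fun a v => by simp [Fin.insertNthEquiv]
  simp only [h, h', Finset.sum_sub_distrib, sum_union_image]
  have h2 : (fun D => (∑ u, ψ u D) / (Fintype.card α : ℝ)) =
      (Fintype.card α : ℝ)⁻¹ • ∑ u, ψ u := by
    ext D
    simp [div_eq_inv_mul]
  rw [h2, map_smul, map_sum]
  simp only [Pi.smul_apply, Finset.sum_apply, smul_eq_mul, ← Finset.mul_sum, Finset.sum_const,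
    Finset.card_univ, Fintype.card_fun, Fintype.card_fin, nsmul_eq_mul]
  push_cast
  field_simp
  ring

end Averaging

/-! ### Choice of the conditioning set. -/

/-- A set `C` of sites that few of the tuples meet, such that given `C` the sites of most of the
tuples are almost independent. -/
theorem exists_conditioning_set {α Ω : Type*} [DecidableEq α] [Fintype α] [DecidableEq Ω]
    [Fintype Ω] [Nonempty α] {p : (α → Ω) → ℝ} (hp : ∀ x, 0 ≤ p x) (hp1 : ∑ x, p x = 1) {r : ℕ}
    (J : (Fin (r + 1) ↪ α) → ℝ) (hJ : ∀ e, 0 ≤ J e) {a b : ℝ} (ha : 0 ≤ a) (hb : 0 ≤ b) {l : ℕ}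
    (hl : 0 < l) :
    ∃ C : Finset α,
      a * ∑ e, J e * ∑ i, (if e i ∈ C then 1 else 0) +
        b * ∑ e, J e * ∑ j, √(predict p (e j) (C ∪ Finset.univ.image (e ∘ j.succAbove)) -
          predict p (e j) C) ≤
      a * ((r + 1) * (l / Fintype.card α * ∑ e, J e)) +
        b * ((r + 1) ^ 2 * ((Fintype.card α : ℝ) ^ (((r + 1 : ℕ) : ℝ) / 2) / √l *
          √(∑ e, J e ^ 2))) := by
  set N : ℝ := (Fintype.card α : ℝ) with hN
  have hN0 : 0 < N := by positivity
  set F : ℝ := √(∑ e, J e ^ 2) with hF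
  -- `t` is, up to the factor `√r`, the size of `√(G C)` for a typical `C`.
  set t : ℝ := N ^ (((r + 1 : ℕ) : ℝ) / 2) / √l with ht
  have ht0 : 0 < t := by positivity
  have ht2 : t ^ 2 = N ^ (r + 1) / l := by
    rw [ht, div_pow, Real.sq_sqrt (by positivity), ← Real.rpow_natCast, ← Real.rpow_mul hN0.le,
      ← Real.rpow_natCast]
    congr 2
    push_cast
    ring
  set ψ : Finset α → ℝ := fun D => (∑ u, predict p u D) / N with hψ
  have hψ0 : ∀ C, 0 ≤ ψ C := fun C =>
    div_nonneg (Finset.sum_nonneg fun u _ => predict_nonneg hp u C) hN0.le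
  have hψ1 : ∀ C, ψ C ≤ 1 := fun C => by
    rw [hψ, div_le_one hN0]
    exact (Finset.sum_le_sum fun u _ => predict_le_one hp hp1 u C).trans (by simp [hN])
  set G : Finset α → ℝ := N ^ (r + 1) • ((avg α ^ r) ψ - ψ) with hG
  have hGE : avgRange α l G ≤ r * t ^ 2 := by
    rw [hG, map_smul, smul_eq_mul, ht2]
    calc _ ≤ N ^ (r + 1) * ((r : ℝ) / l) := by
          gcongr
          exact avgRange_avg_pow_sub_le hψ0 hψ1 l r
      _ = _ := by ring
  let M : Finset α → ℝ := ∑ e, ∑ i, J e • fun C => if e i ∈ C then 1 else 0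
  have hME : avgRange α l M ≤ (r + 1) * (l / N * ∑ e, J e) := by
    simp only [M, map_sum, map_smul, smul_eq_mul]
    calc _ ≤ ∑ e : Fin (r + 1) ↪ α, ∑ i : Fin (r + 1), J e * (l / N) := by
          refine Finset.sum_le_sum fun e _ => Finset.sum_le_sum fun i _ => ?_
          exact mul_le_mul_of_nonneg_left (avgRange_mem_le _ l) (hJ e)
      _ = _ := by
          simp only [Finset.sum_const, Finset.card_univ, Fintype.card_fin, nsmul_eq_mul,
            ← Finset.mul_sum, ← Finset.sum_mul]
          push_cast
          ring
  -- The square root is linearized by `2 √G ≤ t⁻¹ G + t`, so one linear average controls both errors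
  -- at once and a single `C` suits both.
  let Q : Finset α → ℝ := a • M + (b * ((r + 1) * F / 2)) • (t⁻¹ • G + fun _ => t)
  obtain ⟨C, hC⟩ := exists_le_avgRange hl Q
  refine ⟨C, ?_⟩
  have hQ : avgRange α l Q ≤ a * ((r + 1) * (l / N * ∑ e, J e)) +
      b * ((r + 1) ^ 2 * (t * F)) := by
    simp only [Q, map_add, map_smul, smul_eq_mul, avgRange_const hl]
    have h1 : t⁻¹ * avgRange α l G + t ≤ (r + 1) * t := by
      calc _ ≤ t⁻¹ * (r * t ^ 2) + t := by gcongr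
        _ = _ := by field_simp
    have h2 : 0 ≤ (r + 1) * (t * F) * (r + 1) := by positivity
    calc _ ≤ a * ((r + 1) * (l / N * ∑ e, J e)) +
          b * ((r + 1) * F / 2) * ((r + 1) * t) := by gcongr
      _ = a * ((r + 1) * (l / N * ∑ e, J e)) + b * (((r + 1) * (t * F) * (r + 1)) / 2) := by ring
      _ ≤ _ := by
        gcongr
        linarith
  refine le_trans ?_ (hC.trans hQ)
  have hM : M C = ∑ e, J e * ∑ i, (if e i ∈ C then 1 else 0) := by
    simp only [M, Finset.sum_apply, Pi.smul_apply, smul_eq_mul, Finset.mul_sum]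
  have key : ∀ j : Fin (r + 1), ∑ e : Fin (r + 1) ↪ α, J e *
      √(predict p (e j) (C ∪ Finset.univ.image (e ∘ j.succAbove)) - predict p (e j) C) ≤
        F / 2 * (t⁻¹ * G C + t) := by
    intro j
    let Δ : (Fin (r + 1) → α) → ℝ := fun e =>
      predict p (e j) (C ∪ Finset.univ.image (e ∘ j.succAbove)) - predict p (e j) C
    have hΔ : ∀ e, 0 ≤ Δ e := fun e =>
      sub_nonneg.2 (predict_mono hp _ Finset.subset_union_left)
    have hΔG : ∑ e, Δ e = G C := sum_tuples_sub_eq j (predict p) C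
    have hemb : ∑ e : Fin (r + 1) ↪ α, Δ e ≤ G C := by
      -- Tuples of distinct sites are among all tuples, and the increments are nonnegative.
      rw [← hΔG]
      exact (Finset.sum_map Finset.univ ⟨fun e : Fin (r + 1) ↪ α => (e : Fin (r + 1) → α),
        DFunLike.coe_injective⟩ Δ).symm.le.trans (Finset.sum_le_univ_sum_of_nonneg hΔ)
    have hG0 : 0 ≤ G C := hΔG ▸ Finset.sum_nonneg fun e _ => hΔ e
    calc ∑ e : Fin (r + 1) ↪ α, J e * √(Δ e)
        ≤ F * √(∑ e : Fin (r + 1) ↪ α, √(Δ e) ^ 2) := Real.sum_mul_le_sqrt_mul_sqrt _ _ _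
      _ ≤ F * √(G C) := by
          gcongr
          refine le_trans (le_of_eq ?_) hemb
          exact Finset.sum_congr rfl fun e _ => Real.sq_sqrt (hΔ e)
      _ ≤ F * ((t⁻¹ * G C + t) / 2) := by
          gcongr
          have h1 : (√(G C)) ^ 2 = G C := Real.sq_sqrt hG0
          have h2 : t⁻¹ * G C + t - 2 * √(G C) = t⁻¹ * (√(G C) - t) ^ 2 := by
            rw [sub_sq, h1]
            field_simp
            ring
          have h3 : 0 ≤ t⁻¹ * (√(G C) - t) ^ 2 := by positivity
          linarith
      _ = _ := by ring
  have hsum : ∑ e : Fin (r + 1) ↪ α, J e * ∑ j : Fin (r + 1),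
      √(predict p (e j) (C ∪ Finset.univ.image (e ∘ j.succAbove)) - predict p (e j) C) ≤
        (r + 1) * (F / 2 * (t⁻¹ * G C + t)) := by
    simp only [Finset.mul_sum]
    rw [Finset.sum_comm]
    refine (Finset.sum_le_sum fun j _ => key j).trans (le_of_eq ?_)
    simp
  have hQC : Q C = a * M C + b * ((r + 1) * (F / 2 * (t⁻¹ * G C + t))) := by
    simp only [Q, Pi.add_apply, Pi.smul_apply, smul_eq_mul]
    ring
  rw [hQC, hM]
  gcongr

/-! ### Tensor products and local operators. -/

section Tensor

variable {n d : ℕ}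

theorem tensorOp_apply (A : Fin n → Matrix (Fin d) (Fin d) ℂ) (x y : Fin n → Fin d) :
    tensorOp A x y = ∏ u, A u (x u) (y u) := rfl

theorem tensorOp_mul (A B : Fin n → Matrix (Fin d) (Fin d) ℂ) :
    tensorOp A * tensorOp B = tensorOp fun u => A u * B u := by
  ext x y
  simp only [Matrix.mul_apply, tensorOp_apply, ← Finset.prod_mul_distrib]
  rw [Finset.prod_univ_sum, Fintype.piFinset_univ]

theorem tensorOp_one : tensorOp (fun _ : Fin n => (1 : Matrix (Fin d) (Fin d) ℂ)) = 1 := by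
  ext x y
  simp only [tensorOp_apply, Matrix.one_apply, Finset.prod_ite_zero, Finset.prod_const_one,
    Finset.mem_univ, true_imp_iff, funext_iff]

theorem tensorOp_conjTranspose (A : Fin n → Matrix (Fin d) (Fin d) ℂ) :
    (tensorOp A).conjTranspose = tensorOp fun u => (A u).conjTranspose := by
  ext x y
  simp [tensorOp_apply, Matrix.conjTranspose_apply]

theorem trace_tensorOp (A : Fin n → Matrix (Fin d) (Fin d) ℂ) :
    (tensorOp A).trace = ∏ u, (A u).trace := by
  simp only [Matrix.trace, Matrix.diag_apply, tensorOp_apply]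
  rw [Finset.prod_univ_sum, Fintype.piFinset_univ]

theorem tensorOp_sum {κ : Type*} [DecidableEq κ] (s : Fin n → Finset κ)
    (A : Fin n → κ → Matrix (Fin d) (Fin d) ℂ) :
    tensorOp (fun u => ∑ a ∈ s u, A u a) =
      ∑ y ∈ Fintype.piFinset s, tensorOp fun u => A u (y u) := by
  ext x y
  simp only [Matrix.sum_apply, tensorOp_apply]
  rw [Finset.prod_univ_sum]

theorem tensorOp_smul (c : Fin n → ℂ) (A : Fin n → Matrix (Fin d) (Fin d) ℂ) :
    tensorOp (fun u => c u • A u) = (∏ u, c u) • tensorOp A := by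
  ext x y
  simp [tensorOp_apply, Finset.prod_mul_distrib]

theorem tensorOp_update_apply (N : Fin n → Matrix (Fin d) (Fin d) ℂ) (u : Fin n)
    (A : Matrix (Fin d) (Fin d) ℂ) (x y : Fin n → Fin d) :
    tensorOp (Function.update N u A) x y =
      A (x u) (y u) * ∏ v ∈ Finset.univ.erase u, N v (x v) (y v) := by
  rw [tensorOp_apply, ← Finset.mul_prod_erase Finset.univ _ (Finset.mem_univ u)]
  congr 1
  · simp
  · exact Finset.prod_congr rfl fun v hv => by
      rw [Function.update_of_ne (Finset.ne_of_mem_erase hv)]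

theorem exists_conjTranspose_mul_self {m : Type*} [Fintype m] [DecidableEq m] {A : Matrix m m ℂ}
    (hA : A.PosSemidef) : ∃ B : Matrix m m ℂ, A = B.conjTranspose * B := by
  open scoped MatrixOrder in
  exact CStarAlgebra.nonneg_iff_eq_star_mul_self.1 hA.nonneg

theorem posSemidef_tensorOp {A : Fin n → Matrix (Fin d) (Fin d) ℂ}
    (hA : ∀ u, (A u).PosSemidef) : (tensorOp A).PosSemidef := by
  choose B hB using fun u => exists_conjTranspose_mul_self (hA u)
  have : tensorOp A = (tensorOp B).conjTranspose * tensorOp B := by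
    rw [tensorOp_conjTranspose, tensorOp_mul]
    exact congrArg tensorOp (funext hB)
  rw [this]
  exact Matrix.posSemidef_conjTranspose_mul_self _

theorem trace_mul_nonneg {m : Type*} [Fintype m] [DecidableEq m] {A B : Matrix m m ℂ}
    (hA : A.PosSemidef) (hB : B.PosSemidef) : 0 ≤ (A * B).trace := by
  obtain ⟨C, rfl⟩ := exists_conjTranspose_mul_self hB
  rw [← Matrix.mul_assoc, Matrix.trace_mul_comm, ← Matrix.mul_assoc]
  exact (hA.mul_mul_conjTranspose_same C).trace_nonneg

theorem isDensity_tensorOp {τ : Fin n → Matrix (Fin d) (Fin d) ℂ} (hτ : ∀ u, IsDensity (τ u)) :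
    IsDensity (tensorOp τ) :=
  ⟨posSemidef_tensorOp fun u => (hτ u).1, by simp [trace_tensorOp, fun u => (hτ u).2]⟩

theorem convex_setOf_isDensity {m : Type} [Fintype m] :
    Convex ℝ {ρ : Matrix m m ℂ | IsDensity ρ} := by
  rintro A ⟨hA, hA1⟩ B ⟨hB, hB1⟩ a b ha hb hab
  refine ⟨(hA.smul ha).add (hB.smul hb), ?_⟩
  rw [Matrix.trace_add, Matrix.trace_smul, Matrix.trace_smul, hA1, hB1, ← add_smul, hab, one_smul]

theorem IsSeparableState.isDensity {σ : Op (Fin n) d} (hσ : IsSeparableState σ) :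
    IsDensity σ := by
  refine convexHull_min ?_ convex_setOf_isDensity hσ
  rintro _ ⟨τ, hτ, rfl⟩
  exact isDensity_tensorOp hτ

theorem extend_tensorOp {k : ℕ} (e : Fin k ↪ Fin n) (B : Fin k → Matrix (Fin d) (Fin d) ℂ) :
    extend e (tensorOp B) = tensorOp (Function.extend e B fun _ => 1) := by
  ext x y
  rw [tensorOp_apply, ← Finset.prod_mul_prod_compl (Finset.univ.map e), Finset.prod_map]
  have h1 : ∏ u ∈ (Finset.univ.map e)ᶜ, Function.extend e B (fun _ => 1) u (x u) (y u) =
      if ∀ u, (∀ i, e i ≠ u) → x u = y u then 1 else 0 := by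
    have : ∀ u ∈ (Finset.univ.map e)ᶜ, Function.extend e B (fun _ => 1) u (x u) (y u) =
        if x u = y u then 1 else 0 := fun u hu => by
      rw [Function.extend_apply' _ _ _ (by simpa using hu), Matrix.one_apply]
    rw [Finset.prod_congr rfl this, Finset.prod_ite_zero]
    simp
  rw [h1]
  simp [extend, e.injective.extend_apply, tensorOp_apply]

theorem extend_sum_smul {k : ℕ} {κ : Type*} (s : Finset κ) (e : Fin k ↪ Fin n) (c : κ → ℂ)
    (A : κ → Op (Fin k) d) :
    extend e (∑ a ∈ s, c a • A a) = ∑ a ∈ s, c a • extend e (A a) := by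
  ext x y
  simp only [extend, Matrix.of_apply, Matrix.sum_apply, Matrix.smul_apply, smul_ite, smul_zero]
  split_ifs <;> simp

theorem norm_apply_le_specNorm {ι : Type} [Fintype ι] [DecidableEq ι] (A : Op ι d)
    (a b : ι → Fin d) : ‖A a b‖ ≤ specNorm A := by
  have h : A a b = (Matrix.toEuclideanCLM (𝕜 := ℂ) A (EuclideanSpace.single b 1)).ofLp a := by
    rw [Matrix.ofLp_toEuclideanCLM]
    simp
  rw [h]
  refine (PiLp.norm_apply_le _ _).trans ((ContinuousLinearMap.le_opNorm _ _).trans ?_)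
  simp [specNorm]

end Tensor

/-! ### Density matrices as positive functionals. -/

section Functional

variable {d : ℕ}

theorem trace_mul_functional (L : Matrix (Fin d) (Fin d) ℂ →ₗ[ℂ] ℂ)
    (A : Matrix (Fin d) (Fin d) ℂ) :
    (A * Matrix.of fun i j => L (Matrix.single j i 1)).trace = L A := by
  conv_rhs => rw [Matrix.matrix_eq_sum_single A]
  simp only [Matrix.trace, Matrix.diag_apply, Matrix.mul_apply, Matrix.of_apply, map_sum]
  refine Finset.sum_congr rfl fun i _ => Finset.sum_congr rfl fun j _ => ?_
  rw [← smul_eq_mul, ← map_smul, Matrix.smul_single, smul_eq_mul, mul_one]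

/-- Over `ℂ` a real quadratic form already forces the matrix to be Hermitian. -/
theorem posSemidef_of_dotProduct_nonneg {M : Matrix (Fin d) (Fin d) ℂ}
    (h : ∀ v : Fin d → ℂ, 0 ≤ star v ⬝ᵥ M.mulVec v) : M.PosSemidef := by
  rw [← Matrix.isPositive_toEuclideanLin_iff, LinearMap.isPositive_iff_complex]
  intro x
  have hx : inner ℂ (Matrix.toEuclideanLin M x) x = star (star x.ofLp ⬝ᵥ M.mulVec x.ofLp) := by
    rw [EuclideanSpace.inner_eq_star_dotProduct, Matrix.ofLp_toLpLin, Matrix.toLin'_apply,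
      dotProduct_comm, Matrix.star_dotProduct]
  rw [hx]
  obtain ⟨h1, h2⟩ := Complex.le_def.1 (h x.ofLp)
  refine ⟨?_, by simpa using h1⟩
  apply Complex.ext
  · simp
  · simpa using h2.symm

theorem isDensity_functional (L : Matrix (Fin d) (Fin d) ℂ →ₗ[ℂ] ℂ)
    (hL : ∀ A, A.PosSemidef → 0 ≤ L A) (h1 : L 1 = 1) :
    IsDensity (Matrix.of fun i j => L (Matrix.single j i 1)) := by
  refine ⟨posSemidef_of_dotProduct_nonneg fun v => ?_, ?_⟩
  · rw [Matrix.dotProduct_mulVec, dotProduct_comm, ← Matrix.trace_vecMulVec,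
      ← Matrix.vecMulVec_mul, trace_mul_functional]
    exact hL _ (Matrix.posSemidef_vecMulVec_self_star v)
  · have h := trace_mul_functional L 1
    rwa [h1, one_mul] at h

theorem exists_isDensity (hd : 0 < d) : ∃ τ : Matrix (Fin d) (Fin d) ℂ, IsDensity τ :=
  ⟨Matrix.vecMulVec (Pi.single ⟨0, hd⟩ 1) (star (Pi.single ⟨0, hd⟩ 1)),
    Matrix.posSemidef_vecMulVec_self_star _, by simp [Matrix.trace_vecMulVec]⟩

end Functional

/-! ### The informationally complete measurement. -/

section Measurement

variable {d : ℕ}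

/-- The outcomes of an informationally complete measurement of a qudit. -/
abbrev Outcome (d : ℕ) : Type := Fin d × Fin d × Fin 4

/-- An informationally complete measurement: the projections to the vectors
`e_i + I ^ t • e_j`, up to normalization. -/
noncomputable def povm (ω : Outcome d) : Matrix (Fin d) (Fin d) ℂ :=
  (8 * d : ℂ)⁻¹ • Matrix.vecMulVec
    (Pi.single ω.1 1 + Complex.I ^ (ω.2.2 : ℕ) • Pi.single ω.2.1 1)
    (star (Pi.single ω.1 1 + Complex.I ^ (ω.2.2 : ℕ) • Pi.single ω.2.1 1))

theorem posSemidef_povm (ω : Outcome d) : (povm ω).PosSemidef := by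
  refine (Matrix.posSemidef_vecMulVec_self_star _).smul ?_
  have : (8 * d : ℂ)⁻¹ = (((8 * d : ℝ)⁻¹ : ℝ) : ℂ) := by push_cast; rfl
  rw [this, Complex.zero_le_real]
  positivity

theorem povm_apply (a b : Fin d) (t : Fin 4) (x y : Fin d) :
    povm (a, b, t) x y = (8 * d : ℂ)⁻¹ *
      (((if x = a then 1 else 0) + Complex.I ^ (t : ℕ) * if x = b then 1 else 0) *
        ((if y = a then 1 else 0) + (-Complex.I) ^ (t : ℕ) * if y = b then 1 else 0)) := by
  rw [povm, Matrix.smul_apply, Matrix.vecMulVec_apply]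
  simp only [Pi.star_apply, Pi.add_apply, Pi.smul_apply, Pi.single_apply, smul_eq_mul, star_add,
    star_mul', star_pow, Complex.star_def, Complex.conj_I, apply_ite (starRingEnd ℂ), map_one,
    map_zero]

/-- The four phases cancel the cross terms and leave four times the two diagonal projections; summed
over both indices this is `8 * d` times the identity, which explains the normalization. -/
theorem sum_povm (hd : 0 < d) : ∑ ω : Outcome d, povm ω = 1 := by
  have hd' : (d : ℂ) ≠ 0 := by exact_mod_cast hd.ne'
  have key : ∀ a b x y : Fin d, ∑ t, povm (a, b, t) x y = (2 * d : ℂ)⁻¹ *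
      ((if x = a then 1 else 0) * (if y = a then 1 else 0) +
        (if x = b then 1 else 0) * (if y = b then 1 else 0)) := fun a b x y => by
    simp only [povm_apply, Fin.sum_univ_four]
    generalize (if x = a then (1 : ℂ) else 0) = xa
    generalize (if x = b then (1 : ℂ) else 0) = xb
    generalize (if y = a then (1 : ℂ) else 0) = ya
    generalize (if y = b then (1 : ℂ) else 0) = yb
    have hI : Complex.I ^ 2 = -1 := Complex.I_sq
    norm_num [pow_succ]
    field_simp
    linear_combination (-4 * xb * yb) * hI
  ext x y
  simp only [Matrix.sum_apply, Fintype.sum_prod_type, key, ← Finset.mul_sum,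
    Finset.sum_add_distrib, Matrix.one_apply]
  by_cases h : x = y
  · subst h
    simp
    field_simp
    norm_num
  · have h' : ∀ a, (if x = a then (1 : ℂ) else 0) * (if y = a then 1 else 0) = 0 := fun a => by
      split_ifs with h1 h2
      · exact absurd (h1.trans h2.symm) h
      all_goals simp
    simp [h', h]

/-- Polarization: weighting by `I ^ t` keeps only one of the two cross terms. -/
theorem single_eq_sum_povm (hd : 0 < d) (a b : Fin d) :
    Matrix.single a b (1 : ℂ) = ∑ t : Fin 4, (2 * d * Complex.I ^ (t : ℕ)) • povm (a, b, t) := by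
  have hd' : (d : ℂ) ≠ 0 := by exact_mod_cast hd.ne'
  ext x y
  have hs : Matrix.single a b (1 : ℂ) x y =
      (if x = a then 1 else 0) * (if y = b then 1 else 0) := by
    simp only [Matrix.single_apply, eq_comm (a := a), eq_comm (a := b)]
    by_cases h1 : x = a <;> by_cases h2 : y = b <;> simp [h1, h2]
  simp only [Matrix.sum_apply, Matrix.smul_apply, povm_apply, Fin.sum_univ_four, hs]
  generalize (if x = a then (1 : ℂ) else 0) = xa
  generalize (if x = b then (1 : ℂ) else 0) = xb
  generalize (if y = a then (1 : ℂ) else 0) = ya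
  generalize (if y = b then (1 : ℂ) else 0) = yb
  have hI : Complex.I ^ 2 = -1 := Complex.I_sq
  norm_num [pow_succ]
  field_simp
  linear_combination (4 * xa * yb - 4 * xb * ya) * hI

end Measurement

/-! ### Outcome statistics and conditional states. -/

section Outcomes

variable {n d : ℕ}

/-- The probability of the outcome `x` when every qudit of `ρ` is measured. -/
noncomputable def outcomeProb (ρ : Op (Fin n) d) (x : Fin n → Outcome d) : ℝ :=
  (ρ * tensorOp fun u => povm (x u)).trace.re

theorem trace_mul_tensorOp_povm_nonneg {ρ : Op (Fin n) d} (hρ : ρ.PosSemidef)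
    (x : Fin n → Outcome d) : 0 ≤ (ρ * tensorOp fun u => povm (x u)).trace :=
  trace_mul_nonneg hρ (posSemidef_tensorOp fun u => posSemidef_povm (x u))

theorem outcomeProb_nonneg {ρ : Op (Fin n) d} (hρ : ρ.PosSemidef) (x : Fin n → Outcome d) :
    0 ≤ outcomeProb ρ x :=
  (Complex.le_def.1 (trace_mul_tensorOp_povm_nonneg hρ x)).1

theorem ofReal_outcomeProb {ρ : Op (Fin n) d} (hρ : ρ.PosSemidef) (x : Fin n → Outcome d) :
    (outcomeProb ρ x : ℂ) = (ρ * tensorOp fun u => povm (x u)).trace :=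
  Complex.ext rfl (Complex.le_def.1 (trace_mul_tensorOp_povm_nonneg hρ x)).2

theorem sum_piFinset_outcomeProb {ρ : Op (Fin n) d} (hρ : ρ.PosSemidef)
    (s : Fin n → Finset (Outcome d)) :
    ((∑ x ∈ Fintype.piFinset s, outcomeProb ρ x : ℝ) : ℂ) =
      (ρ * tensorOp fun u => ∑ a ∈ s u, povm a).trace := by
  rw [tensorOp_sum s fun _ => povm, Finset.mul_sum, Matrix.trace_sum, Complex.ofReal_sum]
  exact Finset.sum_congr rfl fun x _ => ofReal_outcomeProb hρ x

theorem sum_outcomeProb (hd : 0 < d) {ρ : Op (Fin n) d} (hρ : IsDensity ρ) :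
    ∑ x, outcomeProb ρ x = 1 := by
  have h := sum_piFinset_outcomeProb hρ.1 fun _ => Finset.univ
  simp only [sum_povm hd, tensorOp_one, mul_one, hρ.2, Fintype.piFinset_univ] at h
  exact_mod_cast h

variable {k : ℕ}

/-- The coefficients of an operator in terms of the products of the measurement operators. -/
noncomputable def povmCoeff (A : Op (Fin k) d) (ω : Fin k → Outcome d) : ℂ :=
  A (fun i => (ω i).1) (fun i => (ω i).2.1) * ∏ i, (2 * d * Complex.I ^ ((ω i).2.2 : ℕ))

theorem single_eq_tensorOp (a b : Fin k → Fin d) :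
    Matrix.single a b (1 : ℂ) = tensorOp fun i => Matrix.single (a i) (b i) 1 := by
  ext x y
  simp only [tensorOp_apply, Matrix.single_apply, Finset.prod_ite_zero, Finset.prod_const_one,
    Finset.mem_univ, true_imp_iff, funext_iff, forall_and]

theorem eq_sum_povmCoeff (hd : 0 < d) (A : Op (Fin k) d) :
    A = ∑ ω, povmCoeff A ω • tensorOp fun i => povm (ω i) := by
  conv_lhs => rw [Matrix.matrix_eq_sum_single A]
  rw [← (Equiv.arrowProdEquivProdArrow (Fin k) (fun _ => Fin d)
    (fun _ => Fin d × Fin 4)).symm.sum_comp, Fintype.sum_prod_type]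
  refine Finset.sum_congr rfl fun a _ => ?_
  rw [← (Equiv.arrowProdEquivProdArrow (Fin k) (fun _ => Fin d)
    (fun _ => Fin 4)).symm.sum_comp, Fintype.sum_prod_type]
  refine Finset.sum_congr rfl fun b _ => ?_
  have h : Matrix.single a b (A a b) = A a b • Matrix.single a b (1 : ℂ) := by
    rw [Matrix.smul_single, smul_eq_mul, mul_one]
  have h2 : (fun i => Matrix.single (a i) (b i) (1 : ℂ)) =
      fun i => ∑ t ∈ (Finset.univ : Finset (Fin 4)),
        (2 * d * Complex.I ^ (t : ℕ)) • povm (a i, b i, t) :=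
    funext fun i => single_eq_sum_povm hd (a i) (b i)
  rw [h, single_eq_tensorOp, h2, tensorOp_sum (fun _ => Finset.univ)
    fun i (t : Fin 4) => (2 * d * Complex.I ^ (t : ℕ)) • povm (a i, b i, t),
    Fintype.piFinset_univ, Finset.smul_sum]
  refine Finset.sum_congr rfl fun t _ => ?_
  rw [tensorOp_smul (fun i => (2 * d * Complex.I ^ (t i : ℕ))), smul_smul]
  rfl

theorem norm_povmCoeff_le (A : Op (Fin k) d) (ω : Fin k → Outcome d) :
    ‖povmCoeff A ω‖ ≤ (2 * d) ^ k * specNorm A := by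
  rw [povmCoeff, norm_mul, norm_prod, mul_comm]
  gcongr
  · simp
  · exact norm_apply_le_specNorm _ _ _

theorem trace_extend_mul (hd : 0 < d) (e : Fin k ↪ Fin n) (A : Op (Fin k) d) (η : Op (Fin n) d) :
    (extend e A * η).trace = ∑ ω, povmCoeff A ω *
      (tensorOp (Function.extend e (fun i => povm (ω i)) fun _ => 1) * η).trace := by
  conv_lhs => rw [eq_sum_povmCoeff hd A]
  rw [extend_sum_smul, Finset.sum_mul, Matrix.trace_sum]
  simp [extend_tensorOp]

/-- Summing over the outcomes of the qudits outside `e` turns their factors into the identity, so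
marginals of the outcome distribution are local expectations. -/
theorem sum_outcomeProb_mul_prod_siteInd (hd : 0 < d) (e : Fin k ↪ Fin n)
    (ω : Fin k → Outcome d) {η : Op (Fin n) d} (hη : η.PosSemidef) :
    ((∑ x, outcomeProb η x * ∏ i, siteInd (e i) (ω i) x : ℝ) : ℂ) =
      (tensorOp (Function.extend e (fun i => povm (ω i)) fun _ => 1) * η).trace := by
  have h := sum_piFinset_outcomeProb hη
    (Function.extend e (fun i => {ω i}) fun _ => Finset.univ)
  have h1 : (fun u => ∑ a ∈ Function.extend e (fun i => {ω i}) (fun _ => Finset.univ) u, povm a) =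
      Function.extend e (fun i => povm (ω i)) fun _ => 1 := by
    funext u
    by_cases hu : ∃ i, e i = u
    · obtain ⟨i, rfl⟩ := hu
      simp [e.injective.extend_apply]
    · rw [Function.extend_apply' _ _ _ hu, Function.extend_apply' _ _ _ hu, sum_povm hd]
  rw [h1] at h
  rw [Matrix.trace_mul_comm, ← h]
  congr 1
  simp only [siteInd, Finset.prod_ite_zero, Finset.prod_const_one, mul_ite, mul_one, mul_zero]
  rw [← Finset.sum_filter]
  congr 1
  ext x
  simp only [Finset.mem_filter, Finset.mem_univ, true_and, true_imp_iff, Fintype.mem_piFinset]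
  constructor
  · intro hx u
    by_cases hu : ∃ i, e i = u
    · obtain ⟨i, rfl⟩ := hu
      simp [e.injective.extend_apply, hx i]
    · simp [Function.extend_apply' _ _ _ hu]
  · intro hx i
    simpa [e.injective.extend_apply] using hx (e i)

theorem trace_extend_mul_tensorOp (e : Fin k ↪ Fin n) (B : Fin k → Matrix (Fin d) (Fin d) ℂ)
    {τ : Fin n → Matrix (Fin d) (Fin d) ℂ} (hτ : ∀ u, (τ u).trace = 1) :
    (tensorOp (Function.extend e B fun _ => 1) * tensorOp τ).trace =
      ∏ i, (B i * τ (e i)).trace := by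
  rw [tensorOp_mul, trace_tensorOp, ← Finset.prod_mul_prod_compl (Finset.univ.map e),
    Finset.prod_map]
  have h : ∏ u ∈ (Finset.univ.map e)ᶜ, (Function.extend e B (fun _ => 1) u * τ u).trace = 1 :=
    Finset.prod_eq_one fun u hu => by
      rw [Function.extend_apply' _ _ _ (by simpa using hu), one_mul, hτ]
  rw [h, mul_one]
  simp [e.injective.extend_apply]

/-- The trace is an average of the coefficients against the outcome distribution on `e`. The
resulting constant `(2 * d) ^ k` is crude but depends only on `k` and `d`. -/
theorem norm_trace_extend_mul_le (hd : 0 < d) (e : Fin k ↪ Fin n) (A : Op (Fin k) d)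
    {η : Op (Fin n) d} (hη : IsDensity η) :
    ‖(extend e A * η).trace‖ ≤ (2 * d) ^ k * specNorm A := by
  rw [trace_extend_mul hd]
  have h : ∀ ω : Fin k → Outcome d,
      0 ≤ ∑ x, outcomeProb η x * ∏ i, siteInd (e i) (ω i) x := fun ω =>
    Finset.sum_nonneg fun x _ => mul_nonneg (outcomeProb_nonneg hη.1 x)
      (Finset.prod_nonneg fun i _ => siteInd_nonneg _ _ _)
  have h1 : ∑ ω : Fin k → Outcome d, ∑ x, outcomeProb η x * ∏ i, siteInd (e i) (ω i) x = 1 := by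
    rw [Finset.sum_comm, ← sum_outcomeProb hd hη]
    refine Finset.sum_congr rfl fun x _ => ?_
    have := Finset.prod_univ_sum (fun _ : Fin k => (Finset.univ : Finset (Outcome d)))
      fun i a => siteInd (e i) a x
    rw [Fintype.piFinset_univ] at this
    rw [← Finset.mul_sum, ← this]
    simp [siteInd]
  calc _ ≤ ∑ ω : Fin k → Outcome d, (2 * d) ^ k * specNorm A *
        ∑ x, outcomeProb η x * ∏ i, siteInd (e i) (ω i) x := by
        refine (norm_sum_le _ _).trans (Finset.sum_le_sum fun ω _ => ?_)
        rw [← sum_outcomeProb_mul_prod_siteInd hd e ω hη.1, norm_mul, Complex.norm_real,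
          Real.norm_of_nonneg (h ω)]
        exact mul_le_mul_of_nonneg_right (norm_povmCoeff_le A ω) (h ω)
    _ = _ := by rw [← Finset.mul_sum, h1, mul_one]

/-- The post-measurement state of `u` is obtained as a functional: insert `A` at `u`, the observed
outcomes on `C` and the identity elsewhere, then divide by the probability of those outcomes. It is
positive and normalized, hence given by a density matrix. -/
theorem exists_conditional_state (hd : 0 < d) {ρ : Op (Fin n) d} (hρ : IsDensity ρ)
    (C : Finset (Fin n)) (x : Fin n → Outcome d) (u : Fin n) :
    ∃ τ : Matrix (Fin d) (Fin d) ℂ, IsDensity τ ∧ (u ∉ C → outcomeProb ρ x ≠ 0 → ∀ ω,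
      (povm ω * τ).trace = (condE (outcomeProb ρ) C (siteInd u ω) x : ℂ)) := by
  -- For a measured qudit or a null outcome any density matrix serves.
  by_cases hu : u ∉ C ∧ outcomeProb ρ x ≠ 0
  swap
  · obtain ⟨τ, hτ⟩ := exists_isDensity hd
    exact ⟨τ, hτ, fun h1 h2 => absurd ⟨h1, h2⟩ hu⟩
  obtain ⟨hu, hx⟩ := hu
  let s : Fin n → Finset (Outcome d) := fun v => if v ∈ C then {x v} else Finset.univ
  let N : Fin n → Matrix (Fin d) (Fin d) ℂ := fun v => ∑ a ∈ s v, povm a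
  have hcyl : Fintype.piFinset s = cyl C x := by
    ext y
    simp only [Fintype.mem_piFinset, mem_cyl, s]
    refine forall_congr' fun v => ?_
    by_cases hv : v ∈ C <;> simp [hv]
  have hNu : N u = 1 := by simp [N, s, hu, sum_povm hd]
  have hN : ∀ v, (N v).PosSemidef := fun v =>
    Matrix.posSemidef_sum _ fun a _ => posSemidef_povm a
  set P : ℝ := ∑ y ∈ cyl C x, outcomeProb ρ y with hP
  have hP0 : 0 < P := by
    refine lt_of_lt_of_le ((outcomeProb_nonneg hρ.1 x).lt_of_ne' hx) ?_
    exact Finset.single_le_sum (f := outcomeProb ρ) (fun y _ => outcomeProb_nonneg hρ.1 y)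
      (mem_cyl.2 fun _ _ => rfl)
  have hPN : (P : ℂ) = (ρ * tensorOp N).trace := by
    rw [hP, ← hcyl, sum_piFinset_outcomeProb hρ.1]
  have hP0' : (P : ℂ) ≠ 0 := by exact_mod_cast hP0.ne'
  let L : Matrix (Fin d) (Fin d) ℂ →ₗ[ℂ] ℂ :=
    { toFun := fun A => (ρ * tensorOp (Function.update N u A)).trace / P
      map_add' := fun A B => by
        rw [← add_div, ← Matrix.trace_add, ← mul_add]
        congr 4
        ext a b
        simp only [tensorOp_update_apply, Matrix.add_apply, add_mul]
      map_smul' := fun c A => by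
        have : tensorOp (Function.update N u (c • A)) = c • tensorOp (Function.update N u A) := by
          ext a b
          simp only [tensorOp_update_apply, Matrix.smul_apply, smul_eq_mul, mul_assoc]
        rw [this, Matrix.mul_smul, Matrix.trace_smul, smul_div_assoc]
        rfl }
  have hLapp : ∀ A, L A = (ρ * tensorOp (Function.update N u A)).trace / P := fun _ => rfl
  refine ⟨_, isDensity_functional L (fun A hA => ?_) ?_, fun _ _ ω => ?_⟩
  · rw [hLapp, div_eq_mul_inv, ← Complex.ofReal_inv]
    refine mul_nonneg (trace_mul_nonneg hρ.1 (posSemidef_tensorOp fun v => ?_))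
      (Complex.zero_le_real.2 (inv_nonneg.2 hP0.le))
    by_cases hv : v = u
    · subst hv
      simpa using hA
    · simpa [hv] using hN v
  · rw [hLapp, ← hNu, Function.update_eq_self, ← hPN, div_self hP0']
  · rw [trace_mul_functional, hLapp, condE, Complex.ofReal_div]
    congr 1
    have h := sum_piFinset_outcomeProb hρ.1 (Function.update s u {ω})
    have h1 : (fun v => ∑ a ∈ Function.update s u {ω} v, povm a) =
        Function.update N u (povm ω) := by
      funext v
      by_cases hv : v = u
      · subst hv
        simp
      · simp [hv, N]
    rw [h1] at h
    rw [← h]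
    congr 1
    simp only [siteInd, mul_ite, mul_one, mul_zero]
    rw [← Finset.sum_filter]
    congr 1
    ext y
    simp only [Finset.mem_filter, Fintype.mem_piFinset, ← hcyl]
    constructor
    · intro h
      refine ⟨fun v => ?_, by simpa using h u⟩
      by_cases hv : v = u
      · subst hv
        simp [s, hu]
      · simpa [hv] using h v
    · rintro ⟨h1, h2⟩ v
      by_cases hv : v = u
      · subst hv
        simp [h2]
      · simpa [hv] using h1 v

end Outcomes

/-! ### Approximation by a separable state. -/

section Separable

variable {n d : ℕ}

theorem specNorm_nonneg {ι : Type} [Fintype ι] [DecidableEq ι] (A : Op ι d) : 0 ≤ specNorm A :=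
  norm_nonneg _

theorem LocalHamiltonian.strength_nonneg {k : ℕ} (H : LocalHamiltonian k n d)
    (e : Fin k ↪ Fin n) : 0 ≤ H.strength e := by
  unfold LocalHamiltonian.strength
  split_ifs
  exacts [specNorm_nonneg _, le_rfl]

/-- The states of the qudits in a tuple that avoids `C`, after a measurement of the qudits in `C`,
are close to a product on average, up to the lack of independence of the outcomes. -/
theorem norm_trace_extend_mul_sub_le (hd : 0 < d) {r : ℕ} {ρ : Op (Fin n) d} (hρ : IsDensity ρ)
    {C : Finset (Fin n)} {τ : (Fin n → Outcome d) → Fin n → Matrix (Fin d) (Fin d) ℂ}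
    (hτ : ∀ x u, IsDensity (τ x u))
    (hτC : ∀ x, ∀ u ∉ C, outcomeProb ρ x ≠ 0 → ∀ ω,
      (povm ω * τ x u).trace = (condE (outcomeProb ρ) C (siteInd u ω) x : ℂ))
    (e : Fin (r + 1) ↪ Fin n) (he : ∀ i, e i ∉ C) (A : Op (Fin (r + 1)) d) :
    ‖(extend e A * (ρ - ∑ x, outcomeProb ρ x • tensorOp (τ x))).trace‖ ≤
      (2 * d) ^ (r + 1) * Fintype.card (Fin (r + 1) → Outcome d) * (specNorm A *
        ∑ j, √(predict (outcomeProb ρ) (e j) (C ∪ Finset.univ.image (e ∘ j.succAbove)) -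
          predict (outcomeProb ρ) (e j) C)) := by
  set p := outcomeProb ρ with hp
  have hσ : ∀ ω : Fin (r + 1) → Outcome d,
      (tensorOp (Function.extend e (fun i => povm (ω i)) fun _ => 1) *
        ∑ x, p x • tensorOp (τ x)).trace =
      ((∑ x, p x * ∏ i, condE p C (siteInd (e i) (ω i)) x : ℝ) : ℂ) := by
    intro ω
    rw [Finset.mul_sum, Matrix.trace_sum, Complex.ofReal_sum]
    refine Finset.sum_congr rfl fun x _ => ?_
    rw [Matrix.mul_smul, Matrix.trace_smul, trace_extend_mul_tensorOp e _ fun u => (hτ x u).2,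
      Complex.real_smul, Complex.ofReal_mul, Complex.ofReal_prod]
    by_cases hx : p x = 0
    · simp [hx]
    · congr 1
      exact Finset.prod_congr rfl fun i _ => hτC x (e i) (he i) hx (ω i)
  rw [mul_sub, Matrix.trace_sub, trace_extend_mul hd, trace_extend_mul hd,
    ← Finset.sum_sub_distrib]
  calc _ ≤ ∑ _ω : Fin (r + 1) → Outcome d, (2 * d) ^ (r + 1) * specNorm A *
        ∑ j, √(predict p (e j) (C ∪ Finset.univ.image (e ∘ j.succAbove)) -
          predict p (e j) C) := by
        refine (norm_sum_le _ _).trans (Finset.sum_le_sum fun ω _ => ?_)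
        rw [hσ, ← sum_outcomeProb_mul_prod_siteInd hd e ω hρ.1, ← mul_sub, ← Complex.ofReal_sub,
          norm_mul, Complex.norm_real]
        exact mul_le_mul (norm_povmCoeff_le A ω)
          (abs_sum_prod_siteInd_sub_le (outcomeProb_nonneg hρ.1) (sum_outcomeProb hd hρ) e ω C)
          (norm_nonneg _) (mul_nonneg (by positivity) (specNorm_nonneg A))
    _ = _ := by
        rw [Finset.sum_const, Finset.card_univ, nsmul_eq_mul]
        ring

/-- The constant in the product-state approximation. -/
noncomputable def approxConst (r d : ℕ) : ℝ :=
  2 * (2 * d) ^ (r + 1) * (r + 1) +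
    (2 * d) ^ (r + 1) * Fintype.card (Fin (r + 1) → Outcome d) * (r + 1) ^ 2

theorem approxConst_nonneg (r d : ℕ) : 0 ≤ approxConst r d := by
  unfold approxConst
  positivity

/-- There is no upper bound on `l`: sites are sampled with repetition, and the energy estimate may
call for `l` beyond `n`. -/
theorem exists_separable_approx (hd : 0 < d) (hn : 0 < n) {r : ℕ}
    (H : LocalHamiltonian (r + 1) n d) {ρ : Op (Fin n) d} (hρ : IsDensity ρ) {l : ℕ}
    (hl : 0 < l) :
    ∃ σ : Op (Fin n) d, IsSeparableState σ ∧
      ‖(H.toOp * (ρ - σ)).trace‖ ≤ approxConst r d * ((l : ℝ) / (n : ℝ) * H.strengthL1 +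
        (n : ℝ) ^ (((r + 1 : ℕ) : ℝ) / 2) / √(l : ℝ) * H.strengthFrob) := by
  have : Nonempty (Fin n) := ⟨⟨0, hn⟩⟩
  set p := outcomeProb ρ with hp
  have hp0 : ∀ x, 0 ≤ p x := outcomeProb_nonneg hρ.1
  have hp1 : ∑ x, p x = 1 := sum_outcomeProb hd hρ
  set K : ℝ := (2 * d) ^ (r + 1) with hK
  have hK0 : 0 ≤ K := by positivity
  set W : ℝ := (Fintype.card (Fin (r + 1) → Outcome d) : ℝ) with hW
  have hW0 : 0 ≤ W := by positivity
  obtain ⟨C, hC⟩ := exists_conditioning_set hp0 hp1 H.strength H.strength_nonneg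
    (a := 2 * K) (b := K * W) (by positivity) (by positivity) hl
  choose τ hτ hτC using exists_conditional_state hd hρ C
  have hsep : IsSeparableState (∑ x, p x • tensorOp (τ x)) :=
    (convex_convexHull ℝ _).sum_mem (fun x _ => hp0 x) hp1
      fun x _ => subset_convexHull ℝ _ ⟨τ x, hτ x, rfl⟩
  refine ⟨_, hsep, ?_⟩
  have hF : √(∑ e, H.strength e ^ 2) = H.strengthFrob := rfl
  have hL : ∑ e, H.strength e = H.strengthL1 :=
    Finset.sum_congr rfl fun e _ => (abs_of_nonneg (H.strength_nonneg e)).symm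
  rw [hF, hL, Fintype.card_fin] at hC
  have h0 : 0 ≤ (l : ℝ) / n * H.strengthL1 :=
    mul_nonneg (by positivity) (hL ▸ Finset.sum_nonneg fun e _ => H.strength_nonneg e)
  have h0' : 0 ≤ (n : ℝ) ^ (((r + 1 : ℕ) : ℝ) / 2) / √(l : ℝ) * H.strengthFrob :=
    mul_nonneg (by positivity) (Real.sqrt_nonneg _)
  refine le_trans ?_ (hC.trans ?_)
  swap
  · rw [approxConst, ← hK, ← hW]
    -- `approxConst` is the sum of the two coefficients, so passing to it only adds these
    -- nonnegative cross terms.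
    have h1 : 0 ≤ 2 * K * (r + 1) * ((n : ℝ) ^ (((r + 1 : ℕ) : ℝ) / 2) / √(l : ℝ) *
        H.strengthFrob) := by positivity
    have h2 : 0 ≤ K * W * (r + 1) ^ 2 * ((l : ℝ) / n * H.strengthL1) := by positivity
    linarith
  rw [LocalHamiltonian.toOp, Finset.sum_mul, Matrix.trace_sum, Finset.mul_sum, Finset.mul_sum,
    ← Finset.sum_add_distrib]
  have hterm : ∀ e, 0 ≤ 2 * K * (H.strength e * ∑ i, (if e i ∈ C then 1 else 0)) +
      K * W * (H.strength e * ∑ j, √(predict p (e j)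
        (C ∪ Finset.univ.image (e ∘ j.succAbove)) - predict p (e j) C)) := fun e => by
    have := H.strength_nonneg e
    positivity
  refine (norm_sum_le _ _).trans ((Finset.sum_le_sum fun e he => ?_).trans
    (Finset.sum_le_univ_sum_of_nonneg hterm))
  have hJ : H.strength e = specNorm (H.term e) := if_pos he
  -- A tuple meeting `C` is charged the trivial bound for `ρ` and for `σ`, whence the factor `2 *
  -- K`; the others use near independence.
  by_cases heC : ∃ i, e i ∈ C
  · obtain ⟨i, hi⟩ := heC
    have h1 : (1 : ℝ) ≤ ∑ i, (if e i ∈ C then 1 else 0) := by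
      refine le_trans ?_ (Finset.single_le_sum (f := fun i => if e i ∈ C then (1 : ℝ) else 0)
        (fun i _ => by split_ifs <;> norm_num) (Finset.mem_univ i))
      simp [hi]
    have h2 : 0 ≤ K * W * (H.strength e * ∑ j, √(predict p (e j)
        (C ∪ Finset.univ.image (e ∘ j.succAbove)) - predict p (e j) C)) := by
      have := H.strength_nonneg e
      positivity
    have h3 : ‖(extend e (H.term e) * (ρ - ∑ x, p x • tensorOp (τ x))).trace‖ ≤
        2 * K * H.strength e := by
      rw [mul_sub, Matrix.trace_sub, hJ]
      refine (norm_sub_le _ _).trans ?_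
      linarith [norm_trace_extend_mul_le hd e (H.term e) hρ,
        norm_trace_extend_mul_le hd e (H.term e) hsep.isDensity]
    have h4 : 2 * K * H.strength e * 1 ≤ 2 * K * H.strength e *
        ∑ i, (if e i ∈ C then 1 else 0) :=
      mul_le_mul_of_nonneg_left h1 (mul_nonneg (by positivity) (H.strength_nonneg e))
    linarith
  · push Not at heC
    have h := norm_trace_extend_mul_sub_le hd hρ hτ (fun x u hu => hτC x u hu) e heC (H.term e)
    rw [← hJ] at h
    refine h.trans (le_add_of_nonneg_left ?_)
    have := H.strength_nonneg e
    positivity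

end Separable

/-! ### From separable states to pure product states. -/

section Product

variable {n d : ℕ}

theorem energy_eq_trace (A : Op (Fin n) d) (φ : Space (Fin n) d) :
    energy A φ = (A * Matrix.vecMulVec φ.ofLp (star φ.ofLp)).trace.re := by
  rw [energy, EuclideanSpace.inner_eq_star_dotProduct, Matrix.ofLp_toEuclideanCLM,
    Matrix.mul_vecMulVec, Matrix.trace_vecMulVec]

theorem trace_vecMulVec_star {m : Type} [Fintype m] (φ : EuclideanSpace ℂ m) :
    (Matrix.vecMulVec φ.ofLp (star φ.ofLp)).trace = ((‖φ‖ ^ 2 : ℝ) : ℂ) := by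
  rw [Matrix.trace_vecMulVec, ← EuclideanSpace.inner_eq_star_dotProduct,
    inner_self_eq_norm_sq_to_K]
  simp

theorem isDensity_vecMulVec {m : Type} [Fintype m] {φ : EuclideanSpace ℂ m} (hφ : ‖φ‖ = 1) :
    IsDensity (Matrix.vecMulVec φ.ofLp (star φ.ofLp)) :=
  ⟨Matrix.posSemidef_vecMulVec_self_star _, by rw [trace_vecMulVec_star, hφ]; simp⟩

theorem vecMulVec_tensorVec (ψ : Fin n → EuclideanSpace ℂ (Fin d)) :
    Matrix.vecMulVec (tensorVec ψ).ofLp (star (tensorVec ψ).ofLp) =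
      tensorOp fun u => Matrix.vecMulVec (ψ u).ofLp (star (ψ u).ofLp) := by
  ext x y
  simp [tensorVec, tensorOp_apply, Matrix.vecMulVec_apply, Finset.prod_mul_distrib]

theorem IsDensity.exists_eq_sum_vecMulVec {τ : Matrix (Fin d) (Fin d) ℂ} (hτ : IsDensity τ) :
    ∃ (w : Fin d → ℝ) (v : Fin d → EuclideanSpace ℂ (Fin d)), (∀ i, 0 ≤ w i) ∧ ∑ i, w i = 1 ∧
      (∀ i, ‖v i‖ = 1) ∧
      τ = ∑ i, (w i : ℂ) • Matrix.vecMulVec (v i).ofLp (star (v i).ofLp) := by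
  have hH := hτ.1.isHermitian
  refine ⟨hH.eigenvalues, hH.eigenvectorBasis, hτ.1.eigenvalues_nonneg, ?_,
    fun i => hH.eigenvectorBasis.orthonormal.1 i, ?_⟩
  · have h := hH.trace_eq_sum_eigenvalues
    rw [hτ.2] at h
    simpa using (congrArg Complex.re h).symm
  · conv_lhs => rw [hH.spectral_theorem]
    ext a b
    rw [Unitary.conjStarAlgAut_apply, Matrix.mul_apply]
    simp only [Matrix.mul_diagonal, Matrix.sum_apply, Matrix.smul_apply, Matrix.vecMulVec_apply,
      Matrix.star_apply, Pi.star_apply, smul_eq_mul, Function.comp_apply,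
      Matrix.IsHermitian.eigenvectorUnitary_apply]
    refine Finset.sum_congr rfl fun i _ => ?_
    simp
    ring

/-- Diagonalizing each factor writes `tensorOp τ` as a mixture of pure product states, and the best
of them has at most the average energy. -/
theorem exists_product_energy_le (A : Op (Fin n) d) {τ : Fin n → Matrix (Fin d) (Fin d) ℂ}
    (hτ : ∀ u, IsDensity (τ u)) :
    ∃ ψ : Fin n → EuclideanSpace ℂ (Fin d), (∀ u, ‖ψ u‖ = 1) ∧
      energy A (tensorVec ψ) ≤ (A * tensorOp τ).trace.re := by
  choose w v hw hw1 hv hτv using fun u => (hτ u).exists_eq_sum_vecMulVec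
  let E : (Fin n → Fin d) → ℝ := fun f => energy A (tensorVec fun u => v u (f u))
  let q : (Fin n → Fin d) → ℝ := fun f => ∏ u, w u (f u)
  have hq : ∀ f, 0 ≤ q f := fun f => Finset.prod_nonneg fun u _ => hw u _
  have hq1 : ∑ f, q f = 1 := by
    have := Finset.prod_univ_sum (fun _ : Fin n => (Finset.univ : Finset (Fin d))) w
    rw [Fintype.piFinset_univ] at this
    rw [← this]
    simp [hw1]
  have hsum : (A * tensorOp τ).trace.re = ∑ f, q f * E f := by
    have h1 : tensorOp τ = ∑ f, (q f : ℂ) •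
        tensorOp fun u => Matrix.vecMulVec (v u (f u)).ofLp (star (v u (f u)).ofLp) := by
      conv_lhs => rw [funext hτv]
      rw [tensorOp_sum (fun _ => Finset.univ) fun u i =>
        (w u i : ℂ) • Matrix.vecMulVec (v u i).ofLp (star (v u i).ofLp), Fintype.piFinset_univ]
      refine Finset.sum_congr rfl fun f _ => ?_
      rw [tensorOp_smul (fun u => (w u (f u) : ℂ)), Complex.ofReal_prod]
    rw [h1, Finset.mul_sum, Matrix.trace_sum, Complex.re_sum]
    refine Finset.sum_congr rfl fun f _ => ?_
    rw [Matrix.mul_smul, Matrix.trace_smul, smul_eq_mul, Complex.re_ofReal_mul,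
      ← vecMulVec_tensorVec, ← energy_eq_trace]
  have hne : (Finset.univ : Finset (Fin n → Fin d)).Nonempty := by
    by_contra h
    rw [Finset.not_nonempty_iff_eq_empty.1 h] at hq1
    simp at hq1
  obtain ⟨f, -, hf⟩ := Finset.exists_min_image Finset.univ E hne
  refine ⟨fun u => v u (f u), fun u => hv u _, ?_⟩
  rw [hsum]
  calc E f = ∑ g, q g * E f := by rw [← Finset.sum_mul, hq1, one_mul]
    _ ≤ _ := Finset.sum_le_sum fun g _ =>
      mul_le_mul_of_nonneg_left (hf g (Finset.mem_univ g)) (hq g)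

/-- If every pure product state had larger energy, so would every point of the convex hull, since an
open half-space is convex. -/
theorem IsSeparableState.exists_product_energy_le (A : Op (Fin n) d) {σ : Op (Fin n) d}
    (hσ : IsSeparableState σ) :
    ∃ ψ : Fin n → EuclideanSpace ℂ (Fin d), (∀ u, ‖ψ u‖ = 1) ∧
      energy A (tensorVec ψ) ≤ (A * σ).trace.re := by
  by_contra! h
  have hconv : Convex ℝ {η : Op (Fin n) d | (A * σ).trace.re < (A * η).trace.re} :=
    convex_halfSpace_gt (f := fun η : Op (Fin n) d => (A * η).trace.re)
      ⟨fun η θ => by simp [mul_add], fun c η => by simp⟩ _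
  refine lt_irrefl (A * σ).trace.re (convexHull_min ?_ hconv hσ)
  rintro _ ⟨τ, hτ, rfl⟩
  obtain ⟨ψ, hψ, hle⟩ := Qudit.exists_product_energy_le A hτ
  exact (h ψ hψ).trans_le hle

end Product

/-! ### Bounded interactions and the ground state energy. -/

theorem LocalHamiltonian.strengthL1_le_card {k n d : ℕ} (H : LocalHamiltonian k n d)
    (h : ∀ e ∈ H.edges, specNorm (H.term e) ≤ 1) : H.strengthL1 ≤ H.edges.card := by
  have h1 : ∀ e, |H.strength e| ≤ if e ∈ H.edges then 1 else 0 := fun e => by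
    rw [abs_of_nonneg (H.strength_nonneg e), LocalHamiltonian.strength]
    split_ifs with he
    exacts [h e he, le_rfl]
  refine (Finset.sum_le_sum fun e _ => h1 e).trans ?_
  simp

theorem LocalHamiltonian.strengthFrob_le_sqrt_card {k n d : ℕ} (H : LocalHamiltonian k n d)
    (h : ∀ e ∈ H.edges, specNorm (H.term e) ≤ 1) : H.strengthFrob ≤ √H.edges.card := by
  refine Real.sqrt_le_sqrt ?_
  have h1 : ∀ e, H.strength e ^ 2 ≤ if e ∈ H.edges then 1 else 0 := fun e => by
    rw [LocalHamiltonian.strength]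
    split_ifs with he
    exacts [pow_le_one₀ (specNorm_nonneg _) (h e he), by norm_num]
  refine (Finset.sum_le_sum fun e _ => h1 e).trans ?_
  simp

theorem LocalHamiltonian.card_edges_le {k n d : ℕ} (H : LocalHamiltonian k n d) :
    H.edges.card ≤ n ^ k := by
  refine (Finset.card_le_univ _).trans ?_
  simpa using Fintype.card_le_of_injective (fun e : Fin k ↪ Fin n => (e : Fin k → Fin n))
    DFunLike.coe_injective

/-- The optimal number of measured qudits. -/
theorem exists_measurement_size {N M : ℝ} (hN : 1 ≤ N) (hM : 0 < M) {r : ℕ}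
    (hMN : M ≤ N ^ (r + 1)) :
    ∃ l : ℕ, 0 < l ∧ l / N * M + N ^ (((r + 1 : ℕ) : ℝ) / 2) / √l * √M ≤
      3 * (N ^ ((r : ℝ) / 3) * M ^ ((2 : ℝ) / 3)) := by
  have hN0 : 0 < N := by linarith
  obtain ⟨s, rfl⟩ : ∃ s, N = Real.exp s := ⟨_, (Real.exp_log hN0).symm⟩
  obtain ⟨t, rfl⟩ : ∃ t, M = Real.exp t := ⟨_, (Real.exp_log hM).symm⟩
  have hs : 0 ≤ s := Real.one_le_exp_iff.1 hN
  have hts : t ≤ (r + 1) * s := by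
    rw [← Real.exp_nat_mul] at hMN
    simpa using Real.exp_le_exp.1 hMN
  -- `x = N ^ ((r + 3) / 3) * M ^ (-1 / 3)` is the real value of `l` at which both error terms are
  -- equal, to `y`. Rounding it down costs at most a factor `2` in the second term because `1 ≤ x`.
  set x : ℝ := Real.exp ((r + 3) / 3 * s - t / 3) with hx
  have hx1 : 1 ≤ x := by
    rw [hx, Real.one_le_exp_iff]
    linarith
  set y : ℝ := Real.exp s ^ ((r : ℝ) / 3) * Real.exp t ^ ((2 : ℝ) / 3) with hy
  have hy0 : 0 ≤ y := by positivity
  have h1 : x / Real.exp s * Real.exp t = y := by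
    rw [hx, hy, ← Real.exp_mul, ← Real.exp_mul, ← Real.exp_sub, ← Real.exp_add, ← Real.exp_add]
    congr 1
    ring
  have h2 : Real.exp s ^ (((r + 1 : ℕ) : ℝ) / 2) * √(Real.exp t) = y * √x := by
    rw [hx, hy, ← Real.exp_half, ← Real.exp_half, ← Real.exp_mul, ← Real.exp_mul,
      ← Real.exp_mul, ← Real.exp_add, ← Real.exp_add, ← Real.exp_add]
    congr 1
    push_cast
    ring
  have hl : 0 < ⌊x⌋₊ := Nat.floor_pos.2 hx1
  have hl' : (1 : ℝ) ≤ ⌊x⌋₊ := by exact_mod_cast hl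
  refine ⟨⌊x⌋₊, hl, ?_⟩
  have h3 : √x ≤ 2 * √⌊x⌋₊ := by
    have h4 : (2 : ℝ) = √(2 ^ 2) := by simp
    rw [h4, ← Real.sqrt_mul (by norm_num)]
    refine Real.sqrt_le_sqrt ?_
    linarith [Nat.lt_floor_add_one x]
  have h5 : (⌊x⌋₊ : ℝ) / Real.exp s * Real.exp t ≤ y := by
    rw [← h1]
    gcongr
    exact Nat.floor_le (by linarith)
  have h6 : Real.exp s ^ (((r + 1 : ℕ) : ℝ) / 2) / √⌊x⌋₊ * √(Real.exp t) ≤ 2 * y := by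
    rw [div_mul_eq_mul_div, h2, div_le_iff₀ (by positivity)]
    nlinarith
  linarith

theorem exists_product_energy_le_groundEnergy {r n d : ℕ} (hd : 0 < d)
    (H : LocalHamiltonian (r + 1) n d) (hH : ∀ e ∈ H.edges, specNorm (H.term e) ≤ 1) :
    ∃ ψ : Fin n → EuclideanSpace ℂ (Fin d), (∀ u, ‖ψ u‖ = 1) ∧
      energy H.toOp (tensorVec ψ) ≤ groundEnergy H.toOp + approxConst r d * 3 *
        ((n : ℝ) ^ ((r : ℝ) / 3) * (H.edges.card : ℝ) ^ ((2 : ℝ) / 3)) := by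
  obtain ⟨φ, hφ, hφE⟩ := (isLeast_groundEnergy hd H.toOp).1
  rw [mem_sphere_zero_iff_norm] at hφ
  -- Without interactions both energies and the error vanish; this also covers `n = 0`, where no
  -- tuple exists.
  rcases H.edges.eq_empty_or_nonempty with hE | hE
  · have h0 : H.toOp = 0 := by simp [LocalHamiltonian.toOp, hE]
    refine ⟨fun _ => EuclideanSpace.single ⟨0, hd⟩ 1, by simp, ?_⟩
    rw [← hφE, h0]
    simp [energy, hE]
  have hm : 0 < H.edges.card := hE.card_pos
  have hn : 0 < n := by
    obtain ⟨e, -⟩ := hE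
    exact (e 0).pos
  obtain ⟨l, hl, hle⟩ := exists_measurement_size (N := n) (M := H.edges.card) (r := r)
    (by exact_mod_cast hn) (by exact_mod_cast hm) (by exact_mod_cast H.card_edges_le)
  obtain ⟨σ, hσ, hσH⟩ := exists_separable_approx hd hn H (isDensity_vecMulVec hφ) hl
  obtain ⟨ψ, hψ, hψE⟩ := hσ.exists_product_energy_le H.toOp
  refine ⟨ψ, hψ, hψE.trans ?_⟩
  rw [← hφE, energy_eq_trace]
  rw [mul_sub, Matrix.trace_sub] at hσH
  have h1 := (Complex.abs_re_le_norm _).trans hσH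
  rw [Complex.sub_re] at h1
  have h2 := neg_le_of_abs_le h1
  have h3 : approxConst r d * ((l : ℝ) / (n : ℝ) * H.strengthL1 +
        (n : ℝ) ^ (((r + 1 : ℕ) : ℝ) / 2) / √(l : ℝ) * H.strengthFrob) ≤ approxConst r d * (3 *
        ((n : ℝ) ^ ((r : ℝ) / 3) * (H.edges.card : ℝ) ^ ((2 : ℝ) / 3))) := by
    refine mul_le_mul_of_nonneg_left (le_trans ?_ hle) (approxConst_nonneg r d)
    gcongr
    exacts [H.strengthL1_le_card hH, H.strengthFrob_le_sqrt_card hH]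
  linarith

end Qudit

theorem mainTheorem1 (k d : ℕ) (hk : 0 < k) (hd : 0 < d) :
    (∃ C : ℝ, ∀ (n : ℕ) (H : LocalHamiltonian k n d),
      (∀ e ∈ H.edges, specNorm (H.term e) ≤ 1) →
      ∃ ψ : Fin n → EuclideanSpace ℂ (Fin d), (∀ u, ‖ψ u‖ = 1) ∧
        energy H.toOp (tensorVec ψ) ≤ groundEnergy H.toOp +
          C * ((n : ℝ) ^ (((k : ℝ) - 1) / 3) * (H.edges.card : ℝ) ^ ((2 : ℝ) / 3))) ∧
    (∃ C : ℝ, ∀ (n : ℕ) (H : LocalHamiltonian k n d) (ρ : Op (Fin n) d), IsDensity ρ →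
      ∀ l : ℕ, 0 < l → l < n →
      ∃ σ : Op (Fin n) d, IsSeparableState σ ∧
        ‖(H.toOp * (ρ - σ)).trace‖ ≤
          C * ((l : ℝ) / (n : ℝ) * H.strengthL1 +
            (n : ℝ) ^ ((k : ℝ) / 2) / √(l : ℝ) * H.strengthFrob)) := by
  obtain ⟨r, rfl⟩ : ∃ r, k = r + 1 := ⟨k - 1, by omega⟩
  refine ⟨⟨approxConst r d * 3, fun n H hH => ?_⟩, ⟨approxConst r d, fun n H ρ hρ l hl hln =>
    exists_separable_approx hd (hl.trans hln) H hρ hl⟩⟩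
  have h : (((r + 1 : ℕ) : ℝ) - 1) / 3 = (r : ℝ) / 3 := by push_cast; ring
  rw [h]
  exact exists_product_energy_le_groundEnergy hd H hH
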